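/- **Setting.** Let $\mathcal H=\ell^2(\mathbb N,\mathbb C)$ be the Fock space with its canonical orthonormal basis of Fock states $|0\rangle,|1\rangle,\dots$, and let $\bar B_1$ be its unit sphere. Let $a|n\rangle=\sqrt n\,|n-1\rangle$, $a^\dagger|n\rangle=\sqrt{n+1}\,|n+1\rangle$, $N=a^\dagger a$, and let $D_\alpha=\exp(\alpha(a^\dagger-a))$ for $\alpha\in\mathbb R$ be the displacement operators. For $\theta,\phi\in\mathbb R$ put $M_g=\cos(\theta+N\phi)$ and $M_e=\sin(\theta+N\phi)$. Fix a target $\bar n\in\mathbb N$. Put $\sigma_{\bar n}=0$ and, for $n\neq\bar n$, $$\sigma_0=\tfrac18+\sum_{k=1}^{\bar n}\Big(\tfrac1k-\tfrac1{k^2}\Big),\qquad \sigma_n=\sum_{k=n+1}^{\bar n}\Big(\tfrac1k-\tfrac1{k^2}\Big)\ (1\le n<\bar n),\qquad \sigma_n=\sum_{k=\bar n+1}^{n}\Big(\tfrac1k+\tfrac1{k^2}\Big)\ (n>\bar n).$$ For $\delta>0$ and $\psi\in\bar B_1$ let $$V(\psi)=\sum_{n\ge0}\sigma_n|\langle\psi|n\rangle|^2+\delta\big(\cos^4(\theta+\bar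 n\phi)+\sin^4(\theta+\bar n\phi)\big)-\delta\big(\|M_g\psi\|^4+\|M_e\psi\|^4\big).$$ Given $\bar\alpha>0$, an *argmin feedback* is a measurable function $u:\bar B_1\to[-\bar\alpha,\bar\alpha]$ such that $u(\psi)$ minimizes $\alpha\mapsto V(D_\alpha\psi)$ over $[-\bar\alpha,\bar\alpha]$ for every $\psi$. It defines a Markov chain on $\bar B_1$: given $\psi_k$, for each $s\in\{g,e\}$ one has, with probability $\|M_s\psi_k\|^2$, $\psi_{k+1/2}=M_s\psi_k/\|M_s\psi_k\|$, and then $\psi_{k+1}=D_{\alpha_k}\psi_{k+1/2}$ with $\alpha_k=u(\psi_{k+1/2})$. Let $\Gamma_k(\mu)$ be the law of $\psi_k$ when $\psi_0$ has law $\mu$, and let $\Omega$ be the set of weak-$*$ limits of subsequences of $(\Gamma_k(\mu))_k$. **Theorem.** Assume that the eigenvalues of $M_g$ and those of $M_e$ are non-degenerate (all eigenspaces of $M_g$ and of $M_e$ have dimension at most one). Then for any $\varepsilon>0$ and $C>0$ there are $\delta>0$ and $\bar\alpha>0$ such that $V\ge0$ on $\bar B_1$, an argmin feedback exists, and for every argmin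 feedback and every probability measure $\mu$ on $\bar B_1$ with $\mathbb E_\mu[V]\le C$ the following holds. The set $\Omega$ is non-empty and $\Gamma_k(\mu)$ converges to $\Omega$ (every weak-$*$ neighborhood of $\Omega$ contains $\Gamma_k(\mu)$ for all large $k$). For every $\mu_\infty\in\Omega$, the support of $\mu_\infty$ consists of Fock states up to a global phase, that is, of vectors $z|n\rangle$ with $n\in\mathbb N$, $|z|=1$; and $$\mu_\infty\big(\{z|\bar n\rangle:|z|=1\}\big)\ge1-\varepsilon.$$ -/

import Mathlib

open Filter Topology MeasureTheory ProbabilityTheory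
open scoped ENNReal

namespace Cavity

/-! ### Fock space and the displacement operators -/

/-- The Fock space `ℓ²(ℕ, ℂ)`; the coordinate `ψ n` is `⟨n|ψ⟩`. -/
abbrev Fock : Type := lp (fun _ : ℕ => ℂ) 2

/-- The Fock state `|n⟩`, a vector of the canonical orthonormal basis. -/
noncomputable def ket (n : ℕ) : Fock := lp.single 2 n (1 : ℂ)

/-- Finite superpositions of Fock states, in coordinates. -/
abbrev FiniteState : Type := ℕ →₀ ℂ

/-- `a |n⟩ = √n |n - 1⟩` (for `n = 0` the coefficient is zero). -/
noncomputable def annihilation : FiniteState →ₗ[ℂ] FiniteState :=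
  Finsupp.linearCombination ℂ fun n => Finsupp.single (n - 1) ((Real.sqrt n : ℝ) : ℂ)

/-- `a† |n⟩ = √(n + 1) |n + 1⟩`. -/
noncomputable def creation : FiniteState →ₗ[ℂ] FiniteState :=
  Finsupp.linearCombination ℂ fun n => Finsupp.single (n + 1) ((Real.sqrt (n + 1) : ℝ) : ℂ)

/-- `a† - a` on finite superpositions. -/
noncomputable def generator : FiniteState →ₗ[ℂ] FiniteState := creation - annihilation

/-- The inclusion of finite superpositions in the Fock space. -/
noncomputable def toFock : FiniteState →ₗ[ℂ] Fock := Finsupp.linearCombination ℂ ket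

/-- `(α ^ k / k!) (a† - a) ^ k |n⟩`. -/
noncomputable def displacementTerm (α : ℝ) (n k : ℕ) : Fock :=
  ((α ^ k / (k.factorial : ℝ) : ℝ) : ℂ) • toFock ((generator ^ k) (Finsupp.single n 1))

/-- `exp (α (a† - a)) |n⟩`, by the (norm convergent) exponential series. -/
noncomputable def displacedKet (α : ℝ) (n : ℕ) : Fock := ∑' k : ℕ, displacementTerm α n k

theorem generator_single (n : ℕ) : generator (Finsupp.single n 1) =
    ((Real.sqrt (n + 1) : ℝ) : ℂ) • Finsupp.single (n + 1) (1 : ℂ)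
      - ((Real.sqrt n : ℝ) : ℂ) • Finsupp.single (n - 1) (1 : ℂ) := by
  simp [generator, creation, annihilation, Finsupp.linearCombination_single]

theorem norm_ket (n : ℕ) : ‖ket n‖ = 1 := by
  rw [ket, lp.norm_single (by norm_num)]; simp

theorem inner_ket (m n : ℕ) : inner ℂ (ket m) (ket n) = if m = n then (1 : ℂ) else 0 := by
  rw [ket, lp.inner_single_left, ket, lp.single_apply, Pi.single_apply]
  split_ifs <;> simp

theorem toFock_single (n : ℕ) (z : ℂ) : toFock (Finsupp.single n z) = z • ket n := by
  simp [toFock, Finsupp.linearCombination_single]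

/-- A bound on the norm of `(a† - a) ^ k |n⟩`. -/
noncomputable def genBound (n k : ℕ) : ℝ := 2 ^ k * Real.sqrt ((n + 1).ascFactorial k : ℝ)

theorem genBound_nonneg (n k : ℕ) : 0 ≤ genBound n k := by unfold genBound; positivity

theorem norm_generator_pow_le (k : ℕ) : ∀ n : ℕ,
    ‖toFock ((generator ^ k) (Finsupp.single n 1))‖ ≤ genBound n k := by
  induction k with
  | zero => intro n; simp [genBound, toFock_single, norm_ket]
  | succ k ih =>
    intro n
    rw [pow_succ, Module.End.mul_apply, generator_single, map_sub, map_smul, map_smul, map_sub,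
      map_smul, map_smul]
    have h1 : Real.sqrt (n + 1) * genBound (n + 1) k
        ≤ 2 ^ k * Real.sqrt ((n + 1).ascFactorial (k + 1) : ℝ) := by
      have e : (((n + 1).ascFactorial (k + 1) : ℕ) : ℝ)
          = ((n : ℝ) + 1) * ((n + 1 + 1).ascFactorial k : ℝ) := by
        have := Nat.succ_ascFactorial (n + 1) k
        rw [Nat.ascFactorial_succ, ← this]; push_cast; rfl
      rw [e, Real.sqrt_mul (by positivity), genBound]
      exact le_of_eq (by ring)
    have h2 : Real.sqrt n * genBound (n - 1) k
        ≤ 2 ^ k * Real.sqrt ((n + 1).ascFactorial (k + 1) : ℝ) := by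
      rw [genBound, mul_left_comm, ← Real.sqrt_mul (by positivity)]
      gcongr
      rcases n with _ | m
      · simp
      · have h : (m + 1) * (m + 1).ascFactorial k ≤ (m + 1 + 1).ascFactorial (k + 1) := by
          rw [Nat.ascFactorial_succ]
          exact Nat.mul_le_mul (by omega) (Nat.ascFactorial_le k (by omega))
        exact_mod_cast h
    calc _ ≤ Real.sqrt (n + 1) * genBound (n + 1) k + Real.sqrt n * genBound (n - 1) k := by
          refine (norm_sub_le _ _).trans (add_le_add ?_ ?_) <;> rw [norm_smul]
          · rw [Complex.norm_real, Real.norm_of_nonneg (Real.sqrt_nonneg _)]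
            gcongr; exact ih _
          · rw [Complex.norm_real, Real.norm_of_nonneg (Real.sqrt_nonneg _)]
            gcongr; exact ih _
      _ ≤ genBound n (k + 1) := by
          have e : genBound n (k + 1)
              = 2 * (2 ^ k * Real.sqrt ((n + 1).ascFactorial (k + 1) : ℝ)) := by
            rw [genBound, pow_succ]; ring
          rw [e]; linarith

theorem norm_displacementTerm_le (α R : ℝ) (h : |α| ≤ R) (n k : ℕ) :
    ‖displacementTerm α n k‖ ≤ R ^ k / (k.factorial : ℝ) * genBound n k := by
  rw [displacementTerm, norm_smul, Complex.norm_real, norm_div, norm_pow, Real.norm_eq_abs,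
    Real.norm_of_nonneg (by positivity : (0 : ℝ) ≤ (k.factorial : ℝ))]
  have : 0 ≤ R := (abs_nonneg α).trans h
  gcongr
  exact norm_generator_pow_le k n

theorem summable_bound (R : ℝ) (hR : 0 ≤ R) (n : ℕ) :
    Summable fun k : ℕ => R ^ k / (k.factorial : ℝ) * genBound n k := by
  refine summable_of_ratio_norm_eventually_le (r := 1 / 2) (by norm_num) ?_
  obtain ⟨K, hK⟩ := exists_nat_ge (32 * R ^ 2)
  filter_upwards [eventually_ge_atTop n, eventually_ge_atTop K] with k hk hk'
  have hg := genBound_nonneg n k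
  rw [Real.norm_of_nonneg (by have := genBound_nonneg n (k + 1); positivity),
    Real.norm_of_nonneg (by positivity)]
  have e : R ^ (k + 1) / ((k + 1).factorial : ℝ) * genBound n (k + 1)
      = (R * 2 * Real.sqrt ((n + 1 + k : ℕ) : ℝ) / ((k : ℝ) + 1))
        * (R ^ k / (k.factorial : ℝ) * genBound n k) := by
    rw [genBound, genBound, Nat.ascFactorial_succ, Nat.factorial_succ,
      Nat.cast_mul (n + 1 + k), Real.sqrt_mul (by positivity)]
    push_cast
    field_simp
    ring
  rw [e]
  refine mul_le_mul_of_nonneg_right ?_ (by positivity)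
  rw [div_le_iff₀ (by positivity)]
  refine abs_le_of_sq_le_sq' ?_ (by positivity) |>.2
  have h1 : ((n + 1 + k : ℕ) : ℝ) ≤ 2 * ((k : ℝ) + 1) := by
    have : n + 1 + k ≤ 2 * (k + 1) := by omega
    exact_mod_cast this
  have h2 : 32 * R ^ 2 ≤ (k : ℝ) + 1 := by
    have : (K : ℝ) ≤ k := by exact_mod_cast hk'
    linarith
  rw [mul_pow, Real.sq_sqrt (by positivity)]
  nlinarith [sq_nonneg R]

theorem summable_norm_displacementTerm (α : ℝ) (n : ℕ) :
    Summable fun k : ℕ => ‖displacementTerm α n k‖ :=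
  Summable.of_nonneg_of_le (fun _ => norm_nonneg _)
    (fun k => norm_displacementTerm_le α |α| le_rfl n k) (summable_bound |α| (abs_nonneg α) n)

theorem inner_generator_single (m n : ℕ) :
    inner ℂ (toFock (generator (Finsupp.single m 1))) (toFock (Finsupp.single n 1))
      = -inner ℂ (toFock (Finsupp.single m 1)) (toFock (generator (Finsupp.single n 1))) := by
  simp only [generator_single, map_sub, map_smul, toFock_single, one_smul, inner_sub_left,
    inner_sub_right, inner_smul_left, inner_smul_right, inner_ket, Complex.conj_ofReal]
  rcases m with _ | m <;> rcases n with _ | n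
  · simp
  · by_cases h : n = 0 <;> simp [h, eq_comm]
  · by_cases h : m = 0 <;> simp [h, eq_comm]
  · have e1 : (m + 1 + 1 = n + 1) ↔ (m + 1 = n + 1 - 1) := by omega
    have e2 : (m + 1 - 1 = n + 1) ↔ (m + 1 = n + 1 + 1) := by omega
    simp only [e1, e2]
    split_ifs with h1 h2 h2
    · omega
    · have : n = m + 1 := by omega
      subst this; simp
    · have : m = n + 1 := by omega
      subst this; simp
    · simp

theorem inner_generator (v w : FiniteState) :
    inner ℂ (toFock (generator v)) (toFock w) = -inner ℂ (toFock v) (toFock (generator w)) := by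
  induction v using Finsupp.induction_linear with
  | zero => simp
  | add v₁ v₂ h₁ h₂ => simp only [map_add, inner_add_left, h₁, h₂, neg_add]
  | single m z =>
    induction w using Finsupp.induction_linear with
    | zero => simp
    | add w₁ w₂ h₁ h₂ => simp only [map_add, inner_add_right, h₁, h₂, neg_add]
    | single n y =>
      have ez : Finsupp.single m z = z • Finsupp.single m (1 : ℂ) := by simp
      have ey : Finsupp.single n y = y • Finsupp.single n (1 : ℂ) := by simp
      rw [ez, ey]
      simp only [map_smul, inner_smul_left, inner_smul_right, inner_generator_single, mul_neg]

theorem inner_generator_pow (j : ℕ) : ∀ v w : FiniteState,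
    inner ℂ (toFock ((generator ^ j) v)) (toFock w)
      = (-1) ^ j * inner ℂ (toFock v) (toFock ((generator ^ j) w)) := by
  induction j with
  | zero => intro v w; simp
  | succ j ih =>
    intro v w
    have e1 : (generator ^ (j + 1)) v = generator ((generator ^ j) v) := by
      rw [pow_succ', Module.End.mul_apply]
    have e2 : (generator ^ (j + 1)) w = (generator ^ j) (generator w) := by
      rw [pow_succ, Module.End.mul_apply]
    rw [e1, e2, inner_generator, ih, pow_succ]
    ring

theorem orthonormal_displacedKet (α : ℝ) : Orthonormal ℂ (displacedKet α) := by
  rw [orthonormal_iff_ite]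
  intro m n
  have hm := summable_norm_displacementTerm α m
  have hn := summable_norm_displacementTerm α n
  have key : ∀ j k : ℕ, inner ℂ (displacementTerm α m j) (displacementTerm α n k)
      = (((-α) ^ j / (j.factorial : ℝ) * (α ^ k / (k.factorial : ℝ)) : ℝ) : ℂ)
        * inner ℂ (ket m) (toFock ((generator ^ (j + k)) (Finsupp.single n 1))) := by
    intro j k
    rw [displacementTerm, displacementTerm, inner_smul_left, inner_smul_right,
      inner_generator_pow, Complex.conj_ofReal, pow_add, Module.End.mul_apply, toFock_single,
      one_smul, neg_pow α]
    push_cast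
    ring
  have e1 : inner ℂ (displacedKet α m) (displacedKet α n)
      = ∑' j : ℕ, ∑' k : ℕ, inner ℂ (displacementTerm α m j) (displacementTerm α n k) := by
    have a1 : ∀ x : Fock, inner ℂ x (displacedKet α n)
        = ∑' k : ℕ, inner ℂ x (displacementTerm α n k) := fun x =>
      (innerSL ℂ x).map_tsum hn.of_norm
    have a2 : ∀ y : Fock, inner ℂ (displacedKet α m) y
        = ∑' j : ℕ, inner ℂ (displacementTerm α m j) y := fun y =>
      ((innerSLFlip ℂ) y).map_tsum hm.of_norm
    rw [a2]
    exact tsum_congr fun j => a1 _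
  have hs : Summable fun p : ℕ × ℕ =>
      inner ℂ (displacementTerm α m p.1) (displacementTerm α n p.2) :=
    Summable.of_norm_bounded
      (hm.mul_of_nonneg hn (fun _ => norm_nonneg _) (fun _ => norm_nonneg _))
      (fun p => norm_inner_le_norm _ _)
  have hs' : Summable fun c : Σ p : ℕ, Finset.HasAntidiagonal.antidiagonal p =>
      inner ℂ (displacementTerm α m (Finset.HasAntidiagonal.sigmaAntidiagonalEquivProd c).1)
        (displacementTerm α n (Finset.HasAntidiagonal.sigmaAntidiagonalEquivProd c).2) :=
    Finset.HasAntidiagonal.sigmaAntidiagonalEquivProd.summable_iff.mpr hs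
  rw [e1, ← hs.tsum_prod, ← Finset.HasAntidiagonal.sigmaAntidiagonalEquivProd.tsum_eq,
    hs'.tsum_sigma' (fun n => (hasSum_fintype _).summable), tsum_eq_single 0]
  · simp [Finset.HasAntidiagonal.sigmaAntidiagonalEquivProd, key, toFock_single, inner_ket]
  · intro p hp
    rw [tsum_fintype, Finset.univ_eq_attach]
    refine (Finset.sum_attach (Finset.HasAntidiagonal.antidiagonal p) (fun q : ℕ × ℕ =>
        inner ℂ (displacementTerm α m q.1) (displacementTerm α n q.2))).trans ?_
    have : ∀ q ∈ Finset.HasAntidiagonal.antidiagonal p,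
        inner ℂ (displacementTerm α m q.1) (displacementTerm α n q.2)
        = (((-α) ^ q.1 / (q.1.factorial : ℝ) * (α ^ q.2 / (q.2.factorial : ℝ)) : ℝ) : ℂ)
          * inner ℂ (ket m) (toFock ((generator ^ p) (Finsupp.single n 1))) := by
      intro q hq
      rw [key, Finset.HasAntidiagonal.mem_antidiagonal.mp hq]
    rw [Finset.sum_congr rfl this, ← Finset.sum_mul, ← Complex.ofReal_sum]
    have hz : ∑ q ∈ Finset.HasAntidiagonal.antidiagonal p,
        (-α) ^ q.1 / (q.1.factorial : ℝ) * (α ^ q.2 / (q.2.factorial : ℝ)) = 0 := by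
      have hb := (Commute.all (-α) α).add_pow' p
      rw [neg_add_cancel, zero_pow hp] at hb
      have : ∀ q ∈ Finset.HasAntidiagonal.antidiagonal p,
          (-α) ^ q.1 / (q.1.factorial : ℝ) * (α ^ q.2 / (q.2.factorial : ℝ))
          = (p.choose q.1 • ((-α) ^ q.1 * α ^ q.2)) / (p.factorial : ℝ) := by
        intro q hq
        have hq' := Finset.HasAntidiagonal.mem_antidiagonal.mp hq
        subst hq'
        rw [nsmul_eq_mul, Nat.cast_add_choose]
        field_simp
      rw [Finset.sum_congr rfl this, ← Finset.sum_div, ← hb, zero_div]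
    rw [hz, Complex.ofReal_zero, zero_mul]

/-- The displacement operator `D_α = exp (α (a† - a))`: the isometry of the Fock space with
`D_α |n⟩ = exp (α (a† - a)) |n⟩`. -/
noncomputable def displacement (α : ℝ) : Fock →ₗᵢ[ℂ] Fock :=
  (orthonormal_displacedKet α).orthogonalFamily.linearIsometry

theorem hasSum_displacement (α : ℝ) (ψ : Fock) :
    HasSum (fun n => ψ n • displacedKet α n) (displacement α ψ) :=
  (orthonormal_displacedKet α).orthogonalFamily.hasSum_linearIsometry ψ

theorem displacement_ket (α : ℝ) (n : ℕ) : displacement α (ket n) = displacedKet α n := by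
  rw [ket, displacement, OrthogonalFamily.linearIsometry_apply_single]
  simp

theorem continuous_displacedKet (n : ℕ) : Continuous fun α : ℝ => displacedKet α n := by
  rw [continuous_iff_continuousAt]
  intro α₀
  have h : ContinuousOn (fun α : ℝ => displacedKet α n) (Metric.ball 0 (|α₀| + 1)) := by
    refine continuousOn_tsum (fun k => ?_) (summable_bound (|α₀| + 1) (by positivity) n)
      (fun k α hα => norm_displacementTerm_le α _ ?_ n k)
    · unfold displacementTerm
      fun_prop
    · rw [mem_ball_zero_iff, Real.norm_eq_abs] at hα
      exact hα.le
  refine h.continuousAt (Metric.isOpen_ball.mem_nhds ?_)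
  simp

/-- `α ↦ D_α` is strongly continuous. -/
theorem continuous_displacement (ψ : Fock) : Continuous fun α : ℝ => displacement α ψ := by
  refine continuous_of_uniform_approx_of_continuous fun u hu => ?_
  obtain ⟨ε, hε, hu⟩ := Metric.mem_uniformity_dist.mp hu
  have hs : HasSum (fun n => lp.single 2 n (ψ n)) ψ := lp.hasSum_single (by norm_num) ψ
  obtain ⟨s, hs⟩ := ((Metric.tendsto_nhds.mp hs) ε hε).exists
  refine ⟨fun α => displacement α (∑ n ∈ s, lp.single 2 n (ψ n)), ?_, fun α => hu ?_⟩
  · have : ∀ n, (lp.single 2 n (ψ n) : Fock) = ψ n • ket n := by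
      intro n; rw [ket, ← lp.single_smul]; simp
    simp only [this, map_sum, map_smul, displacement_ket]
    refine continuous_finsetSum _ fun n _ => ?_
    exact (continuous_displacedKet n).const_smul (ψ n)
  · rw [(displacement α).dist_map, dist_comm]
    exact hs

/-! ### States and measurements -/

noncomputable instance instMeasurableSpaceFock : MeasurableSpace Fock := borel Fock

instance instBorelSpaceFock : BorelSpace Fock := ⟨rfl⟩

/-- The cavity states: the unit vectors of the Fock space. -/
abbrev State : Type := Metric.sphere (0 : Fock) 1

theorem State.norm_eq (ψ : State) : ‖(ψ : Fock)‖ = 1 := mem_sphere_zero_iff_norm.mp ψ.2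

theorem memlp_diag (c : ℕ → ℝ) (hc : ∀ n, |c n| ≤ 1) (ψ : Fock) :
    Memℓp (fun n => (c n : ℂ) * ψ n) 2 := by
  refine (lp.memℓp ψ).mono' fun n => ?_
  rw [norm_mul, Complex.norm_real, Real.norm_eq_abs]
  exact mul_le_of_le_one_left (norm_nonneg _) (hc n)

/-- The diagonal operator `|n⟩ ↦ c n |n⟩`. -/
noncomputable def diagonalOp (c : ℕ → ℝ) (hc : ∀ n, |c n| ≤ 1) : Fock →L[ℂ] Fock :=
  LinearMap.mkContinuous
    { toFun := fun ψ => ⟨fun n => (c n : ℂ) * ψ n, memlp_diag c hc ψ⟩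
      map_add' := fun ψ χ => by
        ext n
        exact mul_add _ _ _
      map_smul' := fun z ψ => by
        ext n
        exact mul_left_comm _ _ _ } 1
    (fun ψ => by
      rw [one_mul]
      refine lp.norm_mono (by norm_num) fun n => ?_
      change ‖(c n : ℂ) * ψ n‖ ≤ ‖ψ n‖
      rw [norm_mul, Complex.norm_real, Real.norm_eq_abs]
      exact mul_le_of_le_one_left (norm_nonneg _) (hc n))

theorem diagonalOp_apply (c : ℕ → ℝ) (hc : ∀ n, |c n| ≤ 1) (ψ : Fock) (n : ℕ) :
    diagonalOp c hc ψ n = (c n : ℂ) * ψ n := rfl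

/-- `M_g = cos (θ + N φ)`. -/
noncomputable def measG (θ φ : ℝ) : Fock →L[ℂ] Fock :=
  diagonalOp (fun n => Real.cos (θ + n * φ)) fun _ => Real.abs_cos_le_one _

/-- `M_e = sin (θ + N φ)`. -/
noncomputable def measE (θ φ : ℝ) : Fock →L[ℂ] Fock :=
  diagonalOp (fun n => Real.sin (θ + n * φ)) fun _ => Real.abs_sin_le_one _

/-- All eigenvalues of `T` are non-degenerate: the eigenspaces have dimension at most one. -/
def NondegenerateEigenvalues (T : Fock →L[ℂ] Fock) : Prop :=
  ∀ z : ℂ, Module.rank ℂ (Module.End.eigenspace (T : Fock →ₗ[ℂ] Fock) z) ≤ 1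

theorem norm_sq_measG_add_norm_sq_measE (θ φ : ℝ) (ψ : Fock) :
    ‖measG θ φ ψ‖ ^ 2 + ‖measE θ φ ψ‖ ^ 2 = ‖ψ‖ ^ 2 := by
  have h : ∀ χ : Fock, HasSum (fun n => ‖χ n‖ ^ 2) (‖χ‖ ^ 2) := fun χ => by
    have := lp.hasSum_norm (by norm_num) χ
    simpa using this
  refine ((h _).add (h _)).unique ?_
  convert h ψ using 2 with n
  rw [measG, measE, diagonalOp_apply, diagonalOp_apply, norm_mul, norm_mul, Complex.norm_real,
    Complex.norm_real, mul_pow, mul_pow, Real.norm_eq_abs, Real.norm_eq_abs, sq_abs, sq_abs,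
    ← add_mul, Real.cos_sq_add_sin_sq, one_mul]

open Classical in
/-- The state `M ψ / ‖M ψ‖` after the outcome described by `M`. (If `M ψ = 0`, the outcome has
probability zero, and the value is immaterial.) -/
noncomputable def afterOutcome (M : Fock →L[ℂ] Fock) (ψ : State) : State :=
  if h : M ψ = 0 then ψ
  else ⟨((‖M ψ‖⁻¹ : ℝ) : ℂ) • M ψ, by
    rw [mem_sphere_zero_iff_norm, norm_smul, Complex.norm_real, norm_inv, norm_norm,
      inv_mul_cancel₀ (norm_ne_zero_iff.mpr h)]⟩

/-- `D_α` on states. -/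
noncomputable def displace (α : ℝ) (ψ : State) : State :=
  ⟨displacement α ψ, by
    rw [mem_sphere_zero_iff_norm, LinearIsometry.norm_map, ψ.norm_eq]⟩

theorem measurable_afterOutcome (M : Fock →L[ℂ] Fock) : Measurable (afterOutcome M) := by
  classical
  have hs : MeasurableSet {ψ : State | M ψ = 0} :=
    (isClosed_singleton.preimage (M.continuous.comp continuous_subtype_val)).measurableSet
  refine measurable_of_restrict_of_restrict_compl hs ?_ ?_
  · have : Set.domRestrict {ψ : State | M ψ = 0} (afterOutcome M) = Subtype.val := by
      ext1 ψ
      exact dif_pos ψ.2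
    rw [this]
    exact measurable_subtype_coe
  · refine Continuous.measurable ?_
    rw [Topology.IsInducing.subtypeVal.continuous_iff]
    have : (Subtype.val ∘ Set.domRestrict {ψ : State | M ψ = 0}ᶜ (afterOutcome M))
        = fun ψ : ({ψ : State | M ψ = 0}ᶜ : Set State) => ((‖M (ψ : State)‖⁻¹ : ℝ) : ℂ) • M (ψ : State) := by
      ext1 ψ
      exact congrArg Subtype.val (dif_neg ψ.2)
    rw [this]
    have hM : Continuous fun ψ : ({ψ : State | M ψ = 0}ᶜ : Set State) => M (ψ : State) :=
      M.continuous.comp (continuous_subtype_val.comp continuous_subtype_val)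
    exact (Complex.continuous_ofReal.comp
      (hM.norm.inv₀ fun ψ => norm_ne_zero_iff.mpr ψ.2)).smul hM

theorem continuous_displace_left (ψ : State) : Continuous fun α : ℝ => displace α ψ := by
  rw [Topology.IsInducing.subtypeVal.continuous_iff]
  exact continuous_displacement ψ

theorem continuous_displace (α : ℝ) : Continuous (displace α) := by
  rw [Topology.IsInducing.subtypeVal.continuous_iff]
  exact (displacement α).continuous.comp continuous_subtype_val

theorem measurable_displace_feedback {u : State → ℝ} (hu : Measurable u) :
    Measurable fun ψ : State => displace (u ψ) ψ := by
  have h : Measurable (Function.uncurry displace) :=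
    measurable_uncurry_of_continuous_of_measurable continuous_displace_left
      (fun α => (continuous_displace α).measurable)
  have h' : Measurable fun ψ : State => (u ψ, ψ) := hu.prodMk measurable_id
  have e : (fun ψ : State => displace (u ψ) ψ)
      = Function.uncurry displace ∘ fun ψ : State => (u ψ, ψ) := rfl
  rw [e]
  exact Measurable.comp h h'

/-! ### The closed-loop Markov chain -/

/-- The one-step transition kernel `ψ_k ↦ law of ψ_{k+1}` for the feedback law
`α_k = u ψ_{k+1/2}`. -/
noncomputable def transition (θ φ : ℝ) (u : State → ℝ) (hu : Measurable u) :
    Kernel State State where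
  toFun ψ :=
    ENNReal.ofReal (‖measG θ φ ψ‖ ^ 2) •
        Measure.dirac (displace (u (afterOutcome (measG θ φ) ψ)) (afterOutcome (measG θ φ) ψ))
      + ENNReal.ofReal (‖measE θ φ ψ‖ ^ 2) •
        Measure.dirac (displace (u (afterOutcome (measE θ φ) ψ)) (afterOutcome (measE θ φ) ψ))
  measurable' := by
    have h : ∀ M : Fock →L[ℂ] Fock, Measurable fun ψ : State =>
        ENNReal.ofReal (‖M ψ‖ ^ 2) •
          Measure.dirac (displace (u (afterOutcome M ψ)) (afterOutcome M ψ)) := by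
      intro M
      have h1 : Measurable fun ψ : State => ENNReal.ofReal (‖M ψ‖ ^ 2) :=
        (((M.continuous.comp continuous_subtype_val).norm.pow 2).measurable).ennreal_ofReal
      have h2 : Measurable fun ψ : State =>
          (Measure.dirac (displace (u (afterOutcome M ψ)) (afterOutcome M ψ)) : Measure State) :=
        Measure.measurable_dirac.comp
          ((measurable_displace_feedback hu).comp (measurable_afterOutcome M))
      refine Measure.measurable_of_measurable_coe _ fun s hs => ?_
      simp only [Measure.smul_apply, smul_eq_mul]
      exact h1.mul ((Measure.measurable_coe hs).comp h2)
    exact (h _).add (h _)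

instance isMarkovKernel_transition (θ φ : ℝ) (u : State → ℝ) (hu : Measurable u) :
    IsMarkovKernel (transition θ φ u hu) := by
  refine ⟨fun ψ => ⟨?_⟩⟩
  have e : (transition θ φ u hu ψ) Set.univ
      = ENNReal.ofReal (‖measG θ φ ψ‖ ^ 2) + ENNReal.ofReal (‖measE θ φ ψ‖ ^ 2) := by
    simp [transition, Kernel.coe_mk]
  rw [e, ← ENNReal.ofReal_add (by positivity) (by positivity),
    norm_sq_measG_add_norm_sq_measE, ψ.norm_eq]
  simp

/-- `Γ_k(μ)`: the law of `ψ_k` when `ψ_0` has law `μ`. -/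
noncomputable def law (θ φ : ℝ) (u : State → ℝ) (hu : Measurable u)
    (μ : ProbabilityMeasure State) : ℕ → ProbabilityMeasure State
  | 0 => μ
  | k + 1 => ⟨transition θ φ u hu ∘ₘ (law θ φ u hu μ k : Measure State), inferInstance⟩

/-- The weak-* limit points of a sequence of probability measures: the limits of its
subsequences. -/
def weakLimitPoints (Γ : ℕ → ProbabilityMeasure State) : Set (ProbabilityMeasure State) :=
  {ν | ∃ l : ℕ → ℕ, StrictMono l ∧ Tendsto (fun j => Γ (l j)) atTop (𝓝 ν)}

/-! ### The Lyapunov function and the feedback -/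

/-- The weights `σ_n`. -/
noncomputable def sigma (nbar n : ℕ) : ℝ :=
  if n = nbar then 0
  else if n = 0 then 1 / 8 + ∑ k ∈ Finset.Icc 1 nbar, (1 / (k : ℝ) - 1 / (k : ℝ) ^ 2)
  else if n < nbar then ∑ k ∈ Finset.Icc (n + 1) nbar, (1 / (k : ℝ) - 1 / (k : ℝ) ^ 2)
  else ∑ k ∈ Finset.Icc (nbar + 1) n, (1 / (k : ℝ) + 1 / (k : ℝ) ^ 2)

/-- The Lyapunov function `V`, with values in `(-∞, ∞]`. -/
noncomputable def lyapunov (θ φ : ℝ) (nbar : ℕ) (δ : ℝ) (ψ : State) : EReal :=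
  ((∑' n : ℕ, ENNReal.ofReal (sigma nbar n * ‖(ψ : Fock) n‖ ^ 2) : ℝ≥0∞) : EReal)
    + ((δ * (Real.cos (θ + nbar * φ) ^ 4 + Real.sin (θ + nbar * φ) ^ 4)
        - δ * (‖measG θ φ ψ‖ ^ 4 + ‖measE θ φ ψ‖ ^ 4) : ℝ) : EReal)

/-- `u` is a (measurable) feedback law with `u ψ` a minimizer of `α ↦ V (D_α ψ)` on
`[-ᾱ, ᾱ]` for every state `ψ`. -/
structure IsArgminFeedback (θ φ : ℝ) (nbar : ℕ) (δ αbar : ℝ) (u : State → ℝ) : Prop where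
  measurable : Measurable u
  mem_Icc : ∀ ψ, u ψ ∈ Set.Icc (-αbar) αbar
  isMinOn : ∀ ψ, IsMinOn (fun α => lyapunov θ φ nbar δ (displace α ψ)) (Set.Icc (-αbar) αbar) (u ψ)

/-- The unit vectors that represent the pure state `|n⟩`: `|n⟩` up to a global phase. -/
def fockRay (n : ℕ) : Set State := {ψ | ∃ z : ℂ, ‖z‖ = 1 ∧ (ψ : Fock) = z • ket n}

end Cavity

/-!
# Approximate stabilization of a photon number state

Write `Q(ψ) = ∑ σ_n |⟨n|ψ⟩|²` for the weighted photon number, so that `V = Q + J` with `J` bounded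
by `δ`. The bound `ᾱ = 1` works, and `δ` only has to be small.

*Displacements.* Although `Q` is unbounded, its commutator with `a† - a` is a bounded operator,
since `|σ_{n+1} - σ_n| √(n+1) ≤ 2 / √(n+1)`. With the weights frozen from level `R` on (`cutoff`),
the variation of `Q` under `D_α` is therefore uniformly Cauchy in `R`
(`abs_cutoff_displacement_sub_le`), and `Q(D_α ψ) = Q(ψ) + F(α, ψ)` with a finite function
`F = energyGain` that is continuous in `α` and in `ψ`, even where `Q(ψ) = ∞`. This makes
`α ↦ V(D_α ψ)` continuous up to a constant, whence a measurable argmin feedback.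

*Descent.* At a Fock state `|n⟩` other than the target the second derivative of `α ↦ Q(D_α |n⟩)` is
negative (`sigma_curvature_neg`), so that `F(α, |n⟩) < 0` for some `α` (`exists_energyGain_neg`).
For the finitely many `n` below a level `R`, this gain exceeds `δ`, hence also the variation of `J`.

*Measurements.* A measurement preserves the mean of `Q`. It lowers that of `J` by at least
`2 δ v²`, where `v` is the variance of `cos² (θ + N φ)` (`contrast_measurement`), and `v = 0` only
for Fock states, because the non-degeneracy assumption makes `n ↦ cos² (θ + n φ)` injective.

*Limits.* The mean of `V` thus decreases in each step by at least the mean of a bounded continuous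
function (`decrease`, one for each `α`), which consequently vanishes almost everywhere under every
limit law. So a limit law lives on Fock states, and not on those below `R` other than the target.
The Fock states beyond `R` have little mass since `σ_R` is large while the mean of `Q` is bounded.
As `σ_n → ∞`, a bound on the mean of `Q` also gives tightness, and Prokhorov's theorem provides the
limit laws.
-/

namespace Cavity

/-! ### The weights -/

theorem sigma_self (nbar : ℕ) : sigma nbar nbar = 0 := by simp [sigma]

theorem sigma_of_ge {nbar n : ℕ} (h : nbar ≤ n) :
    sigma nbar n = ∑ k ∈ Finset.Icc (nbar + 1) n, (1 / (k : ℝ) + 1 / (k : ℝ) ^ 2) := by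
  rcases h.eq_or_lt with rfl | h
  · simp [sigma_self]
  · rw [sigma, if_neg h.ne', if_neg (by omega), if_neg (by omega)]

theorem sigma_of_le {nbar n : ℕ} (h0 : n ≠ 0) (h : n ≤ nbar) :
    sigma nbar n = ∑ k ∈ Finset.Icc (n + 1) nbar, (1 / (k : ℝ) - 1 / (k : ℝ) ^ 2) := by
  rcases h.eq_or_lt with rfl | h
  · simp [sigma_self]
  · rw [sigma, if_neg h.ne, if_neg h0, if_pos h]

theorem sigma_zero {nbar : ℕ} (h : nbar ≠ 0) : sigma nbar 0 = 1 / 8 + sigma nbar 1 := by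
  rw [sigma_of_le one_ne_zero (by omega), sigma, if_neg h.symm, if_pos rfl,
    ← Finset.add_sum_Ioc_eq_sum_Icc (show 1 ≤ nbar by omega), ← Finset.Icc_add_one_left_eq_Ioc]
  norm_num

theorem sigma_succ_of_ge {nbar n : ℕ} (h : nbar ≤ n) :
    sigma nbar (n + 1) - sigma nbar n = 1 / ((n : ℝ) + 1) + 1 / ((n : ℝ) + 1) ^ 2 := by
  rw [sigma_of_ge h, sigma_of_ge (by omega), Finset.sum_Icc_succ_top (by omega)]
  push_cast
  ring

theorem sigma_succ_of_lt {nbar n : ℕ} (h0 : n ≠ 0) (h : n < nbar) :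
    sigma nbar (n + 1) - sigma nbar n = -(1 / ((n : ℝ) + 1) - 1 / ((n : ℝ) + 1) ^ 2) := by
  rw [sigma_of_le h0 h.le, sigma_of_le (by omega) (by omega),
    ← Finset.add_sum_Ioc_eq_sum_Icc (show n + 1 ≤ nbar by omega), ← Finset.Icc_add_one_left_eq_Ioc]
  push_cast
  ring

theorem abs_sigma_succ_sub_le (nbar n : ℕ) :
    |sigma nbar (n + 1) - sigma nbar n| ≤ 2 / ((n : ℝ) + 1) := by
  have h1 : 1 / ((n : ℝ) + 1) ^ 2 ≤ 1 / ((n : ℝ) + 1) := by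
    apply one_div_le_one_div_of_le (by positivity)
    nlinarith [Nat.cast_nonneg (α := ℝ) n]
  have h2 : 0 ≤ 1 / ((n : ℝ) + 1) ^ 2 := by positivity
  have h3 : 2 / ((n : ℝ) + 1) = 1 / ((n : ℝ) + 1) + 1 / ((n : ℝ) + 1) := by ring
  rcases le_or_gt nbar n with h | h
  · rw [sigma_succ_of_ge h, abs_le]
    constructor <;> linarith
  · rcases eq_or_ne n 0 with rfl | h0
    · rw [zero_add, sigma_zero (by omega), abs_le]
      norm_num
    · rw [sigma_succ_of_lt h0 h, abs_le]
      constructor <;> linarith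

theorem sigma_le_of_le {nbar m n : ℕ} (hm : nbar ≤ m) (h : m ≤ n) :
    sigma nbar m ≤ sigma nbar n := by
  induction n, h using Nat.le_induction with
  | base => exact le_rfl
  | succ n hmn ih =>
    have := sigma_succ_of_ge (hm.trans hmn)
    have h2 : 0 ≤ 1 / ((n : ℝ) + 1) + 1 / ((n : ℝ) + 1) ^ 2 := by positivity
    linarith

/-- The weights vanish at the target only. -/
theorem sigma_pos {nbar n : ℕ} (h : n ≠ nbar) : 0 < sigma nbar n := by
  have key : ∀ n, n ≠ 0 → n ≤ nbar → 0 ≤ sigma nbar n := fun n h0 h => by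
    rw [sigma_of_le h0 h]
    refine Finset.sum_nonneg fun k hk => ?_
    have hk : (1 : ℝ) ≤ k := by
      have := (Finset.mem_Icc.mp hk).1
      exact_mod_cast (by omega : 1 ≤ k)
    have : 1 / (k : ℝ) ^ 2 ≤ 1 / (k : ℝ) :=
      one_div_le_one_div_of_le (by positivity) (by nlinarith)
    linarith
  rcases lt_or_gt_of_ne h with h | h
  · rcases eq_or_ne n 0 with rfl | h0
    · rw [sigma_zero (by omega)]
      have := key 1 one_ne_zero (by omega)
      linarith
    · have h1 := sigma_succ_of_lt h0 h
      have h2 := key (n + 1) (by omega) (by omega)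
      have hn : (1 : ℝ) ≤ n := by exact_mod_cast (by omega : 1 ≤ n)
      have h3 : 1 / ((n : ℝ) + 1) ^ 2 < 1 / ((n : ℝ) + 1) :=
        one_div_lt_one_div_of_lt (by positivity) (by nlinarith)
      linarith
  · have h1 := sigma_succ_of_ge (le_refl nbar)
    have h2 := sigma_le_of_le (Nat.le_succ nbar) (show nbar + 1 ≤ n from h)
    rw [sigma_self] at h1
    have : 0 < 1 / ((nbar : ℝ) + 1) + 1 / ((nbar : ℝ) + 1) ^ 2 := by positivity
    have h2' : sigma nbar (nbar + 1) ≤ sigma nbar n := h2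
    linarith

theorem sigma_nonneg (nbar n : ℕ) : 0 ≤ sigma nbar n := by
  rcases eq_or_ne n nbar with rfl | h
  · exact (sigma_self n).ge
  · exact (sigma_pos h).le

theorem tendsto_sigma (nbar : ℕ) : Tendsto (sigma nbar) atTop atTop := by
  have h := Real.tendsto_sum_range_one_div_nat_succ_atTop
  refine tendsto_atTop_mono' _ ?_
    (tendsto_atTop_add_const_right _ (-∑ i ∈ Finset.range nbar, 1 / ((i : ℝ) + 1)) h)
  filter_upwards [eventually_ge_atTop nbar] with n hn
  induction n, hn using Nat.le_induction with
  | base => rw [sigma_self]; linarith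
  | succ n hmn ih =>
    have := sigma_succ_of_ge hmn
    rw [Finset.sum_range_succ]
    have h2 : 0 ≤ 1 / ((n : ℝ) + 1) ^ 2 := by positivity
    linarith

/-- There is a positive lower bound of the weights off the target. -/
theorem exists_sigma_lower_bound (nbar : ℕ) :
    ∃ s : ℝ, 0 < s ∧ ∀ n, n ≠ nbar → s ≤ sigma nbar n := by
  obtain ⟨N, hN⟩ := eventually_atTop.mp ((tendsto_sigma nbar).eventually_ge_atTop 1)
  rcases ((Finset.range N).filter (· ≠ nbar)).eq_empty_or_nonempty with he | hne
  · refine ⟨1, one_pos, fun n hn => hN n ?_⟩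
    by_contra h
    have : n ∈ (Finset.range N).filter (· ≠ nbar) := by simp [hn]; omega
    simp [he] at this
  · obtain ⟨m, hm, hmin⟩ := Finset.exists_min_image _ (sigma nbar) hne
    refine ⟨min 1 (sigma nbar m), lt_min one_pos (sigma_pos (Finset.mem_filter.mp hm).2),
      fun n hn => ?_⟩
    rcases le_or_gt N n with h | h
    · exact (min_le_left _ _).trans (hN n h)
    · exact (min_le_right _ _).trans (hmin n (by simp [hn, h]))

/-- Half the second derivative of `α ↦ ∑ σ_m |⟨m|D_α n⟩|²` at `α = 0` is negative unless `n` is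
the target: the Fock states other than the target are not local minimizers. -/
theorem sigma_curvature_neg {nbar n : ℕ} (h : n ≠ nbar) :
    (sigma nbar (n + 1) - sigma nbar n) * ((n : ℝ) + 1)
      - (sigma nbar n - sigma nbar (n - 1)) * n < 0 := by
  have hd : ∀ x : ℝ, 0 < x → 1 / (x + 1) < 1 / x := fun x hx =>
    one_div_lt_one_div_of_lt hx (by linarith)
  rcases n with _ | _ | n
  · rw [zero_add, sigma_zero (by omega)]; norm_num
  · have h2 := sigma_zero (nbar := nbar)
    rcases eq_or_ne nbar 0 with rfl | h0
    · have := sigma_succ_of_ge (nbar := 0) (n := 1) (by omega)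
      have h1 := sigma_succ_of_ge (nbar := 0) (n := 0) (by omega)
      norm_num at this h1 ⊢
      linarith
    · have := sigma_succ_of_lt (nbar := nbar) one_ne_zero (by omega)
      have h3 := h2 h0
      norm_num at this h3 ⊢
      linarith
  · have e : ∀ x : ℝ, 0 < x → (1 / x + 1 / x ^ 2) * x = 1 + 1 / x := fun x hx => by field_simp
    have e' : ∀ x : ℝ, 0 < x → (1 / x - 1 / x ^ 2) * x = 1 - 1 / x := fun x hx => by field_simp
    have hlt := hd ((n : ℝ) + 1 + 1) (by positivity)
    have f1 := e ((n : ℝ) + 1 + 1) (by positivity)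
    have f2 := e ((n : ℝ) + 1 + 1 + 1) (by positivity)
    have g1 := e' ((n : ℝ) + 1 + 1) (by positivity)
    have g2 := e' ((n : ℝ) + 1 + 1 + 1) (by positivity)
    rcases lt_or_gt_of_ne h with h | h
    · have a1 := sigma_succ_of_lt (nbar := nbar) (n := n + 1) (by omega) (by omega)
      have a2 := sigma_succ_of_lt (nbar := nbar) (n := n + 1 + 1) (by omega) (by omega)
      rw [Nat.add_sub_cancel, a1, a2]
      push_cast
      linarith
    · have a1 := sigma_succ_of_ge (nbar := nbar) (n := n + 1) (by omega)
      have a2 := sigma_succ_of_ge (nbar := nbar) (n := n + 1 + 1) (by omega)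
      rw [Nat.add_sub_cancel, a1, a2]
      push_cast
      linarith

/-! ### The displacement flow in coordinates -/

theorem inner_ket_left (m : ℕ) (x : Fock) : inner ℂ (ket m) x = x m := by
  rw [ket, lp.inner_single_left]; simp

theorem ket_apply (n m : ℕ) : ket n m = if m = n then (1 : ℂ) else 0 := by
  rw [ket, lp.single_apply, Pi.single_apply]

theorem hasSum_norm_sq (x : Fock) : HasSum (fun n => ‖x n‖ ^ 2) (‖x‖ ^ 2) := by
  have := lp.hasSum_norm (by norm_num) x
  simpa using this

theorem hasSum_ket (x : Fock) : HasSum (fun n => x n • ket n) x := by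
  have hs : HasSum (fun n => lp.single 2 n (x n)) x := lp.hasSum_single (by norm_num) x
  convert hs using 2 with n
  rw [ket, ← lp.single_smul]; simp

theorem denseRange_toFock : DenseRange toFock := by
  intro x
  refine mem_closure_of_tendsto (hasSum_ket x) (Eventually.of_forall fun s => ?_)
  refine ⟨∑ n ∈ s, Finsupp.single n (x n), ?_⟩
  simp [toFock_single]

theorem continuous_coord (n : ℕ) : Continuous fun x : Fock => x n := by
  simp_rw [← inner_ket_left]
  fun_prop

theorem hasSum_displacement_toFock (α : ℝ) (v : FiniteState) :
    HasSum (fun k : ℕ => ((α ^ k / (k.factorial : ℝ) : ℝ) : ℂ) • toFock ((generator ^ k) v))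
      (displacement α (toFock v)) := by
  induction v using Finsupp.induction_linear with
  | zero => simp
  | add v w hv hw => simpa only [map_add, smul_add] using hv.add hw
  | single n z =>
    have h : HasSum (displacementTerm α n) (displacedKet α n) :=
      (summable_norm_displacementTerm α n).of_norm.hasSum
    have h2 := h.const_smul z
    have ez : Finsupp.single n z = z • Finsupp.single n (1 : ℂ) := by simp
    rw [ez, map_smul, map_smul, toFock_single, one_smul, displacement_ket]
    convert h2 using 2 with k
    rw [displacementTerm, map_smul, map_smul, smul_comm]

theorem displacement_zero_toFock (v : FiniteState) : displacement 0 (toFock v) = toFock v := by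
  refine (hasSum_displacement_toFock 0 v).unique ?_
  convert hasSum_single (0 : ℕ) (fun k hk => ?_) using 1
  · simp
  · simp [hk]

/-- `D_α` commutes with its generator, which is antisymmetric. -/
theorem inner_displacement_generator (α : ℝ) (v w : FiniteState) :
    inner ℂ (toFock w) (displacement α (toFock (generator v)))
      = -inner ℂ (toFock (generator w)) (displacement α (toFock v)) := by
  have h1 := (innerSL ℂ (toFock w)).hasSum (hasSum_displacement_toFock α (generator v))
  have h2 := ((innerSL ℂ (toFock (generator w))).hasSum (hasSum_displacement_toFock α v)).neg
  refine h1.unique (h2.congr_fun fun k => ?_)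
  simp only [innerSL_apply_apply, inner_smul_right]
  rw [← Module.End.mul_apply, ← pow_succ, pow_succ', Module.End.mul_apply, inner_generator]
  ring

theorem hasDerivAt_displacedKet (n : ℕ) (α : ℝ) :
    HasDerivAt (fun a => displacedKet a n)
      (displacement α (toFock (generator (Finsupp.single n 1)))) α := by
  set T : ℕ → ℝ → Fock := fun k a => ((√(n + 1) : ℝ) : ℂ) • displacementTerm a (n + 1) k
    - ((√n : ℝ) : ℂ) • displacementTerm a (n - 1) k with hT
  have hterm : ∀ k a, HasDerivAt (fun a => displacementTerm a n (k + 1)) (T k a) a := by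
    intro k a
    have h1 : HasDerivAt (fun a : ℝ => a ^ (k + 1) / ((k + 1).factorial : ℝ))
        (a ^ k / (k.factorial : ℝ)) a := by
      have := (hasDerivAt_pow (k + 1) a).div_const ((k + 1).factorial : ℝ)
      refine this.congr_deriv ?_
      rw [Nat.factorial_succ]
      push_cast
      field_simp
    have h2 := (h1.ofReal_comp).smul_const (toFock ((generator ^ (k + 1)) (Finsupp.single n 1)))
    refine h2.congr_deriv ?_
    simp only [hT, displacementTerm]
    rw [pow_succ, Module.End.mul_apply, generator_single, map_sub, map_smul, map_smul, map_sub,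
      map_smul, map_smul, smul_sub, smul_comm, smul_comm ((√n : ℝ) : ℂ)]
  have hs : ∀ a, Summable fun k => displacementTerm a n k :=
    fun a => (summable_norm_displacementTerm a n).of_norm
  have e : (fun a => displacedKet a n)
      = fun a => displacementTerm a n 0 + ∑' k, displacementTerm a n (k + 1) :=
    funext fun a => (hs a).tsum_eq_zero_add
  have e0 : (fun a => displacementTerm a n 0) = fun _ => ket n := by
    funext a; simp [displacementTerm, toFock_single]
  have hval : displacement α (toFock (generator (Finsupp.single n 1))) = ∑' k, T k α := by
    have h1 : HasSum (displacementTerm α (n + 1)) (displacedKet α (n + 1)) :=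
      (summable_norm_displacementTerm α _).of_norm.hasSum
    have h2 : HasSum (displacementTerm α (n - 1)) (displacedKet α (n - 1)) :=
      (summable_norm_displacementTerm α _).of_norm.hasSum
    rw [((h1.const_smul ((√(n + 1) : ℝ) : ℂ)).sub (h2.const_smul ((√n : ℝ) : ℂ))).tsum_eq,
      generator_single]
    simp only [map_sub, map_smul, toFock_single, one_smul, displacement_ket]
  rw [e, hval]
  have e1 : (∑' k, T k α) = 0 + ∑' k, T k α := (zero_add _).symm
  rw [e1]
  refine HasDerivAt.add (by rw [e0]; exact hasDerivAt_const _ _) ?_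
  have hR : 0 ≤ |α| + 1 := by positivity
  refine hasDerivAt_tsum_of_isPreconnected
    (((summable_bound (|α| + 1) hR (n + 1)).mul_left (√(n + 1))).add
      ((summable_bound (|α| + 1) hR (n - 1)).mul_left (√n)))
    (t := Metric.ball 0 (|α| + 1)) Metric.isOpen_ball (convex_ball _ _).isPreconnected
    (fun k a _ => hterm k a) (fun k a ha => ?_) (y₀ := α) (by simp)
    ((summable_nat_add_iff 1).mpr (hs α)) (by simp)
  have ha' : |a| ≤ |α| + 1 := by
    rw [mem_ball_zero_iff, Real.norm_eq_abs] at ha; exact ha.le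
  refine (norm_sub_le _ _).trans ?_
  rw [norm_smul, norm_smul, Complex.norm_real, Complex.norm_real,
    Real.norm_of_nonneg (Real.sqrt_nonneg _), Real.norm_of_nonneg (Real.sqrt_nonneg _)]
  exact add_le_add
    (mul_le_mul_of_nonneg_left (norm_displacementTerm_le a _ ha' _ k) (Real.sqrt_nonneg _))
    (mul_le_mul_of_nonneg_left (norm_displacementTerm_le a _ ha' _ k) (Real.sqrt_nonneg _))

theorem hasDerivAt_displacement_toFock (v : FiniteState) (α : ℝ) :
    HasDerivAt (fun a => displacement a (toFock v)) (displacement α (toFock (generator v))) α := by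
  induction v using Finsupp.induction_linear with
  | zero => simpa using hasDerivAt_const _ _
  | add v w hv hw => simpa only [map_add] using hv.fun_add hw
  | single n z =>
    have ez : Finsupp.single n z = z • Finsupp.single n (1 : ℂ) := by simp
    have h := (hasDerivAt_displacedKet n α).const_smul z
    rw [ez]
    simp only [map_smul, toFock_single, one_smul, displacement_ket]
    exact h

/-- The Schrödinger equation of `D_α` in coordinates. -/
theorem hasDerivAt_displacement_apply (v : FiniteState) (m : ℕ) (α : ℝ) :
    HasDerivAt (fun a => displacement a (toFock v) m)
      (((√m : ℝ) : ℂ) * displacement α (toFock v) (m - 1)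
        - ((√(m + 1) : ℝ) : ℂ) * displacement α (toFock v) (m + 1)) α := by
  have h := ((innerSL ℂ (ket m)).restrictScalars ℝ).hasFDerivAt.comp_hasDerivAt α
    (hasDerivAt_displacement_toFock v α)
  have e : ((innerSL ℂ (ket m)).restrictScalars ℝ) (displacement α (toFock (generator v)))
      = ((√m : ℝ) : ℂ) * displacement α (toFock v) (m - 1)
        - ((√(m + 1) : ℝ) : ℂ) * displacement α (toFock v) (m + 1) := by
    have h2 := inner_displacement_generator α v (Finsupp.single m 1)
    rw [toFock_single, one_smul] at h2
    change inner ℂ (ket m) _ = _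
    rw [h2, generator_single]
    simp only [map_sub, map_smul, toFock_single, one_smul, inner_sub_left, inner_smul_left,
      Complex.conj_ofReal, inner_ket_left]
    ring
  rw [e] at h
  refine h.congr_of_eventuallyEq (Eventually.of_forall fun a => ?_)
  exact (inner_ket_left m _).symm

/-! ### Truncated weights along the flow -/

/-- The quadratic form `∑ σ_{min n R} |ψ n|²`, in which the weights are frozen from `R` on. It is
written as `σ_R ‖ψ‖²` minus a finite sum, and is therefore continuous. -/
noncomputable def cutoff (nbar R : ℕ) (x : Fock) : ℝ :=
  sigma nbar R * ‖x‖ ^ 2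
    - ∑ n ∈ Finset.range R, (sigma nbar R - sigma nbar n) * ‖x n‖ ^ 2

/-- The flow of probability from level `m - 1` to level `m`, up to a factor of two. -/
noncomputable def current (x : Fock) (m : ℕ) : ℝ := √m * inner ℝ (x m) (x (m - 1))

theorem continuous_cutoff (nbar R : ℕ) : Continuous (cutoff nbar R) := by
  unfold cutoff
  refine Continuous.sub (by fun_prop) (continuous_finsetSum _ fun n _ => ?_)
  exact ((continuous_coord n).norm.pow 2).const_mul _

theorem hasDerivAt_norm_sq_displacement (v : FiniteState) (m : ℕ) (α : ℝ) :
    HasDerivAt (fun a => ‖displacement a (toFock v) m‖ ^ 2)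
      (2 * (current (displacement α (toFock v)) m - current (displacement α (toFock v)) (m + 1)))
      α := by
  refine (hasDerivAt_displacement_apply v m α).norm_sq.congr_deriv ?_
  have e : ∀ (r : ℝ) (z : ℂ), (r : ℂ) * z = r • z := fun r z => by simp
  rw [e, e, inner_sub_right, inner_smul_right, inner_smul_right, current, current,
    Nat.add_sub_cancel, real_inner_comm (displacement α (toFock v) m)]
  push_cast
  ring

/-- Summation by parts. -/
theorem sum_mul_sub_eq_of_zero (s j : ℕ → ℝ) (c : ℝ) (R : ℕ) (hj : j 0 = 0) :
    ∑ n ∈ Finset.range R, (c - s n) * (j n - j (n + 1))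
      = -(c - s R) * j R - ∑ n ∈ Finset.range R, (s (n + 1) - s n) * j (n + 1) := by
  induction R with
  | zero => simp [hj]
  | succ R ih => rw [Finset.sum_range_succ, Finset.sum_range_succ, ih]; ring

theorem hasDerivAt_cutoff_displacement (nbar R : ℕ) (v : FiniteState) (α : ℝ) :
    HasDerivAt (fun a => cutoff nbar R (displacement a (toFock v)))
      (2 * ∑ n ∈ Finset.range R, (sigma nbar (n + 1) - sigma nbar n)
        * current (displacement α (toFock v)) (n + 1)) α := by
  have h := HasDerivAt.fun_sum (u := Finset.range R) fun n _ =>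
    (hasDerivAt_norm_sq_displacement v n α).const_mul (sigma nbar R - sigma nbar n)
  have h2 := h.const_sub (sigma nbar R * ‖toFock v‖ ^ 2)
  have e : (fun a => cutoff nbar R (displacement a (toFock v)))
      = fun a => sigma nbar R * ‖toFock v‖ ^ 2 - ∑ n ∈ Finset.range R,
        (sigma nbar R - sigma nbar n) * ‖displacement a (toFock v) n‖ ^ 2 := by
    funext a; rw [cutoff, LinearIsometry.norm_map]
  rw [e]
  refine h2.congr_deriv ?_
  have h3 := sum_mul_sub_eq_of_zero (sigma nbar) (current (displacement α (toFock v)))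
    (sigma nbar R) R (by simp [current])
  rw [sub_self, neg_zero, zero_mul, zero_sub] at h3
  simp_rw [mul_left_comm _ (2 : ℝ), ← Finset.mul_sum]
  rw [h3]
  ring

theorem abs_current_succ_le (x : Fock) (n : ℕ) :
    |current x (n + 1)| ≤ √(n + 1) * ((‖x n‖ ^ 2 + ‖x (n + 1)‖ ^ 2) / 2) := by
  rw [current, abs_mul, abs_of_nonneg (Real.sqrt_nonneg _), Nat.add_sub_cancel]
  push_cast
  refine mul_le_mul_of_nonneg_left ((abs_real_inner_le_norm _ _).trans ?_) (Real.sqrt_nonneg _)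
  nlinarith [sq_nonneg (‖x n‖ - ‖x (n + 1)‖)]

theorem sum_norm_sq_le (x : Fock) (s : Finset ℕ) : ∑ n ∈ s, ‖x n‖ ^ 2 ≤ ‖x‖ ^ 2 :=
  sum_le_hasSum s (fun _ _ => by positivity) (hasSum_norm_sq x)

theorem sum_norm_sq_succ_le (x : Fock) (s : Finset ℕ) :
    ∑ n ∈ s, ‖x (n + 1)‖ ^ 2 ≤ ‖x‖ ^ 2 := by
  have := sum_norm_sq_le x (s.map (addRightEmbedding 1))
  simpa using this

theorem abs_sigma_mul_current_le (nbar : ℕ) (x : Fock) (n : ℕ) :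
    |(sigma nbar (n + 1) - sigma nbar n) * current x (n + 1)|
      ≤ 1 / √(n + 1) * (‖x n‖ ^ 2 + ‖x (n + 1)‖ ^ 2) := by
  rw [abs_mul]
  refine (mul_le_mul (abs_sigma_succ_sub_le nbar n) (abs_current_succ_le x n) (abs_nonneg _)
    (by positivity)).trans (le_of_eq ?_)
  have h : √((n : ℝ) + 1) * √((n : ℝ) + 1) = n + 1 := Real.mul_self_sqrt (by positivity)
  have h0 : √((n : ℝ) + 1) ≠ 0 := by positivity
  generalize √((n : ℝ) + 1) = r at h h0
  rw [← h]
  field_simp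

/-- The variation of the truncated weights under `D_α` is uniformly Cauchy in the truncation: the
commutator of `σ_N` with `a† - a` is a bounded operator whose tail is small. -/
theorem abs_cutoff_displacement_sub_le (nbar : ℕ) {R R' : ℕ} (h : R ≤ R') (α : ℝ) (x : Fock) :
    |(cutoff nbar R' (displacement α x) - cutoff nbar R' x)
        - (cutoff nbar R (displacement α x) - cutoff nbar R x)|
      ≤ 4 / √(R + 1) * ‖x‖ ^ 2 * |α| := by
  refine denseRange_toFock.induction_on (p := fun x => |(cutoff nbar R' (displacement α x)
    - cutoff nbar R' x) - (cutoff nbar R (displacement α x) - cutoff nbar R x)|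
      ≤ 4 / √(R + 1) * ‖x‖ ^ 2 * |α|) x ?_ fun v => ?_
  · have hc := fun S => (continuous_cutoff nbar S).comp (displacement α).continuous
    exact isClosed_le ((((hc R').sub (continuous_cutoff nbar R')).sub
      ((hc R).sub (continuous_cutoff nbar R))).abs) (by fun_prop)
  · set y := fun a => displacement a (toFock v) with hy
    have hd := fun a => (hasDerivAt_cutoff_displacement nbar R' v a).sub
      (hasDerivAt_cutoff_displacement nbar R v a)
    have hb := Convex.norm_image_sub_le_of_norm_hasDerivWithin_le (s := Set.univ) (x := 0) (y := α)
      (C := 4 / √(R + 1) * ‖toFock v‖ ^ 2) (fun a _ => (hd a).hasDerivWithinAt) (fun a _ => ?_)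
      convex_univ trivial trivial
    · simp only [Pi.sub_apply, displacement_zero_toFock, sub_zero, Real.norm_eq_abs] at hb
      refine le_trans (le_of_eq ?_) hb
      congr 1
      ring
    · rw [← mul_sub, ← Finset.sum_Ico_eq_sub _ h, Real.norm_eq_abs, abs_mul, abs_two]
      have hn : ‖displacement a (toFock v)‖ ^ 2 = ‖toFock v‖ ^ 2 := by
        rw [LinearIsometry.norm_map]
      have h1 : ∀ n ∈ Finset.Ico R R', |(sigma nbar (n + 1) - sigma nbar n) * current (y a) (n + 1)|
          ≤ 1 / √(R + 1) * (‖y a n‖ ^ 2 + ‖y a (n + 1)‖ ^ 2) := fun n hn => by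
        refine (abs_sigma_mul_current_le nbar (y a) n).trans ?_
        have : R ≤ n := (Finset.mem_Ico.mp hn).1
        gcongr
      have h2 := (Finset.abs_sum_le_sum_abs _ _).trans (Finset.sum_le_sum h1)
      rw [← Finset.mul_sum, Finset.sum_add_distrib] at h2
      have h3 := sum_norm_sq_le (y a) (Finset.Ico R R')
      have h4 := sum_norm_sq_succ_le (y a) (Finset.Ico R R')
      have h5 : 1 / √((R : ℝ) + 1) * (∑ n ∈ Finset.Ico R R', ‖y a n‖ ^ 2
          + ∑ n ∈ Finset.Ico R R', ‖y a (n + 1)‖ ^ 2)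
          ≤ 1 / √((R : ℝ) + 1) * (‖y a‖ ^ 2 + ‖y a‖ ^ 2) := by gcongr
      have h6 := h2.trans h5
      rw [hy] at h6
      simp only [hn] at h6
      refine (mul_le_mul_of_nonneg_left h6 zero_le_two).trans (le_of_eq ?_)
      ring

/-! ### The weighted photon number and its variation under displacements -/

/-- The weighted photon number `∑ σ_n |ψ n|²`, which may be infinite. -/
noncomputable def energy (nbar : ℕ) (x : Fock) : ℝ≥0∞ :=
  ∑' n : ℕ, ENNReal.ofReal (sigma nbar n * ‖x n‖ ^ 2)

theorem cutoff_eq (nbar R : ℕ) (x : Fock) :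
    cutoff nbar R x = ∑ n ∈ Finset.range R, sigma nbar n * ‖x n‖ ^ 2
      + sigma nbar R * (‖x‖ ^ 2 - ∑ n ∈ Finset.range R, ‖x n‖ ^ 2) := by
  simp only [cutoff, sub_mul, Finset.sum_sub_distrib, ← Finset.mul_sum]
  ring

theorem sum_range_le_cutoff (nbar R : ℕ) (x : Fock) :
    ∑ n ∈ Finset.range R, sigma nbar n * ‖x n‖ ^ 2 ≤ cutoff nbar R x := by
  rw [cutoff_eq]
  have := mul_nonneg (sigma_nonneg nbar R) (sub_nonneg.mpr (sum_norm_sq_le x (Finset.range R)))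
  linarith

theorem cutoff_nonneg (nbar R : ℕ) (x : Fock) : 0 ≤ cutoff nbar R x :=
  (Finset.sum_nonneg fun n _ => mul_nonneg (sigma_nonneg nbar n) (by positivity)).trans
    (sum_range_le_cutoff nbar R x)

theorem cutoff_smul (nbar R : ℕ) (c : ℂ) (x : Fock) :
    cutoff nbar R (c • x) = ‖c‖ ^ 2 * cutoff nbar R x := by
  have : ∀ n, ‖(c • x) n‖ ^ 2 = ‖c‖ ^ 2 * ‖x n‖ ^ 2 := fun n => by
    rw [lp.coeFn_smul, Pi.smul_apply, norm_smul, mul_pow]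
  simp only [cutoff, this, norm_smul, mul_pow, mul_sub, Finset.mul_sum]
  congr 1
  · ring
  · exact Finset.sum_congr rfl fun n _ => by ring

theorem hasSum_tail (x : Fock) (R : ℕ) :
    HasSum (fun n => ‖x (n + R)‖ ^ 2) (‖x‖ ^ 2 - ∑ n ∈ Finset.range R, ‖x n‖ ^ 2) :=
  (hasSum_nat_add_iff' (f := fun n => ‖x n‖ ^ 2) R).mpr (hasSum_norm_sq x)

theorem ofReal_cutoff_le_energy {nbar R : ℕ} (h : nbar ≤ R) (x : Fock) :
    ENNReal.ofReal (cutoff nbar R x) ≤ energy nbar x := by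
  have h0 : ∀ n, 0 ≤ sigma nbar n * ‖x n‖ ^ 2 := fun n =>
    mul_nonneg (sigma_nonneg nbar n) (sq_nonneg _)
  have hs : HasSum (fun n => sigma nbar R * ‖x (n + R)‖ ^ 2)
      (sigma nbar R * (‖x‖ ^ 2 - ∑ n ∈ Finset.range R, ‖x n‖ ^ 2)) :=
    (hasSum_tail x R).mul_left _
  have htail : ENNReal.ofReal (sigma nbar R * (‖x‖ ^ 2 - ∑ n ∈ Finset.range R, ‖x n‖ ^ 2))
      ≤ ∑' n, ENNReal.ofReal (sigma nbar (n + R) * ‖x (n + R)‖ ^ 2) := by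
    rw [← hs.tsum_eq, ENNReal.ofReal_tsum_of_nonneg
      (fun n => mul_nonneg (sigma_nonneg nbar R) (sq_nonneg _)) hs.summable]
    refine ENNReal.tsum_le_tsum fun n => ENNReal.ofReal_le_ofReal ?_
    exact mul_le_mul_of_nonneg_right (sigma_le_of_le h (by omega)) (sq_nonneg _)
  have hsplit : ∑ n ∈ Finset.range R, ENNReal.ofReal (sigma nbar n * ‖x n‖ ^ 2)
      + ∑' n, ENNReal.ofReal (sigma nbar (n + R) * ‖x (n + R)‖ ^ 2) = energy nbar x :=
    Summable.sum_add_tsum_nat_add' (f := fun n => ENNReal.ofReal (sigma nbar n * ‖x n‖ ^ 2))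
      ENNReal.summable
  rw [cutoff_eq, ← hsplit]
  refine ENNReal.ofReal_add_le.trans (add_le_add ?_ htail)
  rw [ENNReal.ofReal_sum_of_nonneg fun n _ => h0 n]

theorem tendsto_cutoff (nbar : ℕ) (x : Fock) :
    Tendsto (fun R => ENNReal.ofReal (cutoff nbar R x)) atTop (𝓝 (energy nbar x)) := by
  refine tendsto_of_tendsto_of_tendsto_of_le_of_le'
    (ENNReal.tendsto_nat_tsum fun n => ENNReal.ofReal (sigma nbar n * ‖x n‖ ^ 2))
    tendsto_const_nhds (Eventually.of_forall fun R => ?_) ?_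
  · rw [← ENNReal.ofReal_sum_of_nonneg fun n _ =>
      mul_nonneg (sigma_nonneg nbar n) (by positivity)]
    exact ENNReal.ofReal_le_ofReal (sum_range_le_cutoff nbar R x)
  · filter_upwards [eventually_ge_atTop nbar] with R hR using ofReal_cutoff_le_energy hR x

theorem tendsto_const_div_sqrt (c : ℝ) :
    Tendsto (fun R : ℕ => c / √((R : ℝ) + 1)) atTop (𝓝 0) :=
  tendsto_const_nhds.div_atTop
    (Real.tendsto_sqrt_atTop.comp (tendsto_atTop_add_const_right _ 1 tendsto_natCast_atTop_atTop))

/-- The variation `∑ σ_n |⟨n|D_α ψ⟩|² - ∑ σ_n |⟨n|ψ⟩|²`. The difference of the truncated sums has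
a finite limit even where both sums are infinite. -/
noncomputable def energyGain (nbar : ℕ) (α : ℝ) (x : Fock) : ℝ :=
  limUnder atTop fun R => cutoff nbar R (displacement α x) - cutoff nbar R x

theorem tendsto_energyGain (nbar : ℕ) (α : ℝ) (x : Fock) :
    Tendsto (fun R => cutoff nbar R (displacement α x) - cutoff nbar R x) atTop
      (𝓝 (energyGain nbar α x)) := by
  refine CauchySeq.tendsto_limUnder (cauchySeq_of_le_tendsto_0'
    (fun R : ℕ => 4 / √(R + 1) * ‖x‖ ^ 2 * |α|) (fun R R' h => ?_) ?_)
  · rw [dist_comm, Real.dist_eq]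
    exact abs_cutoff_displacement_sub_le nbar h α x
  · have := ((tendsto_const_div_sqrt 4).mul_const (‖x‖ ^ 2)).mul_const |α|
    simpa only [zero_mul] using this

theorem abs_energyGain_sub_le (nbar R : ℕ) (α : ℝ) (x : Fock) :
    |energyGain nbar α x - (cutoff nbar R (displacement α x) - cutoff nbar R x)|
      ≤ 4 / √(R + 1) * (‖x‖ ^ 2 * |α|) := by
  rw [← mul_assoc]
  refine le_of_tendsto ((tendsto_energyGain nbar α x).sub_const _).abs ?_
  filter_upwards [eventually_ge_atTop R] with R' h using abs_cutoff_displacement_sub_le nbar h α x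

/-- Continuity of a limit that is locally uniform because the error factors. -/
theorem continuous_of_abs_sub_le {X : Type*} [TopologicalSpace X] {f : ℕ → X → ℝ} {g b : X → ℝ}
    {c : ℕ → ℝ} (hf : ∀ n, Continuous (f n)) (hb : Continuous b) (hc : Tendsto c atTop (𝓝 0))
    (h : ∀ n x, |g x - f n x| ≤ c n * b x) : Continuous g := by
  have hu : TendstoLocallyUniformly f g atTop := by
    rw [Metric.tendstoLocallyUniformly_iff]
    intro ε hε x
    refine ⟨{y | |b y| < |b x| + 1}, (isOpen_lt hb.abs continuous_const).mem_nhds (by simp), ?_⟩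
    have h1 : Tendsto (fun n => |c n| * (|b x| + 1)) atTop (𝓝 0) := by
      simpa using hc.abs.mul_const (|b x| + 1)
    filter_upwards [h1.eventually_lt_const hε] with n hn y hy
    refine ((h n y).trans ((le_abs_self _).trans ?_)).trans_lt hn
    rw [abs_mul]
    exact mul_le_mul_of_nonneg_left (le_of_lt hy) (abs_nonneg _)
  exact hu.continuous (Eventually.of_forall hf).frequently

theorem continuous_energyGain (nbar : ℕ) (α : ℝ) : Continuous (energyGain nbar α) :=
  continuous_of_abs_sub_le
    (fun R => ((continuous_cutoff nbar R).comp (displacement α).continuous).sub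
      (continuous_cutoff nbar R))
    (by fun_prop : Continuous fun x : Fock => ‖x‖ ^ 2 * |α|) (tendsto_const_div_sqrt 4)
    (fun R x => abs_energyGain_sub_le nbar R α x)

theorem continuous_energyGain_left (nbar : ℕ) (x : Fock) :
    Continuous fun α => energyGain nbar α x :=
  continuous_of_abs_sub_le
    (fun R => ((continuous_cutoff nbar R).comp (continuous_displacement x)).sub continuous_const)
    (by fun_prop : Continuous fun α : ℝ => ‖x‖ ^ 2 * |α|) (tendsto_const_div_sqrt 4)
    (fun R α => abs_energyGain_sub_le nbar R α x)

theorem energyGain_smul (nbar : ℕ) (α : ℝ) (c : ℂ) (x : Fock) :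
    energyGain nbar α (c • x) = ‖c‖ ^ 2 * energyGain nbar α x := by
  refine tendsto_nhds_unique (tendsto_energyGain nbar α (c • x)) ?_
  simp only [map_smul, cutoff_smul, ← mul_sub]
  exact (tendsto_energyGain nbar α x).const_mul _

theorem abs_energyGain_le (nbar : ℕ) (α : ℝ) (x : Fock) :
    |energyGain nbar α x| ≤ 4 * (‖x‖ ^ 2 * |α|) := by
  have := abs_energyGain_sub_le nbar 0 α x
  simpa [cutoff] using this

/-- This holds also when both weighted photon numbers are infinite. -/
theorem energy_displacement (nbar : ℕ) (α : ℝ) (x : Fock) :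
    (energy nbar (displacement α x) : EReal) = energy nbar x + (energyGain nbar α x : EReal) := by
  have hc : ∀ y : Fock, Tendsto (fun R => ((cutoff nbar R y : ℝ) : EReal)) atTop
      (𝓝 (energy nbar y : EReal)) := fun y => by
    have := (continuous_coe_ennreal_ereal.tendsto _).comp (tendsto_cutoff nbar y)
    refine this.congr fun R => ?_
    simp [Function.comp, EReal.coe_ennreal_ofReal, cutoff_nonneg]
  have hg := (continuous_coe_real_ereal.tendsto _).comp (tendsto_energyGain nbar α x)
  have hadd := (EReal.continuousAt_add
    (p := ((energy nbar x : EReal), (energyGain nbar α x : EReal)))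
    (Or.inr (EReal.coe_ne_bot _)) (Or.inr (EReal.coe_ne_top _))).tendsto.comp
    ((hc x).prodMk_nhds hg)
  refine tendsto_nhds_unique (hc _) (hadd.congr fun R => ?_)
  simp only [Function.comp, ← EReal.coe_add]
  congr 1
  ring

/-! ### Descent directions at the Fock states -/

theorem current_zero (x : Fock) : current x 0 = 0 := by simp [current]

/-- Near `|n⟩`, only the transitions from and to the level `n` matter to first order. -/
theorem sum_current_le {nbar n R : ℕ} (h : n < R) (x : Fock) :
    ∑ m ∈ Finset.range R, (sigma nbar (m + 1) - sigma nbar m) * current x (m + 1)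
      ≤ (sigma nbar (n + 1) - sigma nbar n) * current x (n + 1)
        + (sigma nbar n - sigma nbar (n - 1)) * current x n + 2 * (‖x‖ ^ 2 - ‖x n‖ ^ 2) := by
  set t : ℕ → ℝ := fun m => (sigma nbar (m + 1) - sigma nbar m) * current x (m + 1) with ht
  set y : ℕ → ℝ := fun m => ‖x m‖ ^ 2 - if m = n then ‖x n‖ ^ 2 else 0 with hy
  have hy0 : ∀ m, 0 ≤ y m := fun m => by
    simp only [hy]
    split_ifs with hm
    · rw [hm, sub_self]
    · rw [sub_zero]; positivity
  have hys : HasSum y (‖x‖ ^ 2 - ‖x n‖ ^ 2) := (hasSum_norm_sq x).sub (hasSum_ite_eq n _)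
  have h1 : ∑ m ∈ Finset.range R, y m ≤ ‖x‖ ^ 2 - ‖x n‖ ^ 2 :=
    sum_le_hasSum _ (fun m _ => hy0 m) hys
  have h2 : ∑ m ∈ Finset.range R, y (m + 1) ≤ ‖x‖ ^ 2 - ‖x n‖ ^ 2 := by
    have := sum_le_hasSum ((Finset.range R).map (addRightEmbedding 1)) (fun m _ => hy0 m) hys
    simpa only [Finset.sum_map, addRightEmbedding_apply] using this
  have hterm : ∀ m, t m ≤ (if m = n then t m else 0) + (if m + 1 = n then t m else 0)
      + (y m + y (m + 1)) := fun m => by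
    have a1 := hy0 m
    have a2 := hy0 (m + 1)
    by_cases hm : m = n
    · rw [if_pos hm, if_neg (by omega)]; linarith
    by_cases hm' : m + 1 = n
    · rw [if_neg hm, if_pos hm']; linarith
    rw [if_neg hm, if_neg hm']
    simp only [hy, if_neg hm, if_neg hm', sub_zero]
    have a3 := (le_abs_self _).trans (abs_sigma_mul_current_le nbar x m)
    have a4 : 1 / √((m : ℝ) + 1) ≤ 1 := by
      rw [div_le_one (by positivity)]
      exact Real.one_le_sqrt.mpr (by linarith [Nat.cast_nonneg (α := ℝ) m])
    have a5 := mul_le_mul_of_nonneg_right a4 (by positivity : 0 ≤ ‖x m‖ ^ 2 + ‖x (m + 1)‖ ^ 2)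
    linarith
  have h3 : ∑ m ∈ Finset.range R, (if m = n then t m else 0)
      = (sigma nbar (n + 1) - sigma nbar n) * current x (n + 1) := by
    rw [Finset.sum_ite_eq' , if_pos (Finset.mem_range.mpr h)]
  have h4 : ∑ m ∈ Finset.range R, (if m + 1 = n then t m else 0)
      = (sigma nbar n - sigma nbar (n - 1)) * current x n := by
    rcases n with _ | n
    · simp [current_zero]
    · simp only [Nat.add_right_cancel_iff]
      rw [Finset.sum_ite_eq', if_pos (Finset.mem_range.mpr (by omega))]
      rfl
  have h5 := Finset.sum_le_sum fun m (_ : m ∈ Finset.range R) => hterm m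
  simp only [Finset.sum_add_distrib] at h5
  rw [h3, h4] at h5
  linarith

theorem displacement_zero_ket (n : ℕ) : displacement 0 (ket n) = ket n := by
  have := displacement_zero_toFock (Finsupp.single n 1)
  rwa [toFock_single, one_smul] at this

theorem hasDerivAt_current_displacedKet_succ (n : ℕ) :
    HasDerivAt (fun a => current (displacement a (ket n)) (n + 1)) ((n : ℝ) + 1) 0 := by
  have hd := fun m => hasDerivAt_displacement_apply (Finsupp.single n 1) m 0
  simp only [toFock_single, one_smul] at hd
  have h0 := displacement_zero_ket n
  have h := ((hd (n + 1)).inner ℝ (hd n)).const_mul (√((n + 1 : ℕ) : ℝ))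
  refine h.congr_deriv ?_
  have h1 : (√((n : ℝ) + 1)) * √((n : ℝ) + 1) = n + 1 := Real.mul_self_sqrt (by positivity)
  have h2 : n + 1 + 1 ≠ n := by omega
  simp [h0, ket_apply, h1, h2]

theorem hasDerivAt_current_displacedKet (n : ℕ) :
    HasDerivAt (fun a => current (displacement a (ket n)) n) (-(n : ℝ)) 0 := by
  rcases n with _ | n
  · simpa [current_zero] using hasDerivAt_const (0 : ℝ) (0 : ℝ)
  have hd := fun m => hasDerivAt_displacement_apply (Finsupp.single (n + 1) 1) m 0
  simp only [toFock_single, one_smul] at hd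
  have h0 := displacement_zero_ket (n + 1)
  have h := ((hd (n + 1)).inner ℝ (hd n)).const_mul (√((n + 1 : ℕ) : ℝ))
  refine h.congr_deriv ?_
  have h1 : (√((n : ℝ) + 1)) * √((n : ℝ) + 1) = n + 1 := Real.mul_self_sqrt (by positivity)
  simp [h0, ket_apply, h1, add_comm]

/-- Off the target, a small displacement of a Fock state lowers its weighted photon number. -/
theorem exists_energyGain_neg {nbar n : ℕ} (h : n ≠ nbar) :
    ∃ α ∈ Set.Icc (-1 : ℝ) 1, energyGain nbar α (ket n) < 0 := by
  set κ := (sigma nbar (n + 1) - sigma nbar n) * ((n : ℝ) + 1)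
    - (sigma nbar n - sigma nbar (n - 1)) * n with hκ
  have hneg : κ < 0 := sigma_curvature_neg h
  set y : ℝ → Fock := fun a => displacement a (ket n) with hy
  -- A bound of the derivative of all truncated sums, with derivative `2 κ` at zero.
  set Φ : ℝ → ℝ := fun a => 2 * ((sigma nbar (n + 1) - sigma nbar n) * current (y a) (n + 1)
        + (sigma nbar n - sigma nbar (n - 1)) * current (y a) n + 2 * (1 - ‖y a n‖ ^ 2)) with hΦ
  have h0 := displacement_zero_ket n
  have hΦ0 : Φ 0 = 0 := by
    have h2 : n + 1 ≠ n := by omega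
    rcases n with _ | n
    · simp [hΦ, hy, h0, current, ket_apply]
    · have h3 : n ≠ n + 1 := by omega
      simp [hΦ, hy, h0, current, ket_apply]
  have hΦd : HasDerivAt Φ (2 * κ) 0 := by
    have h1 := (hasDerivAt_current_displacedKet_succ n).const_mul
      (sigma nbar (n + 1) - sigma nbar n)
    have h2 := (hasDerivAt_current_displacedKet n).const_mul (sigma nbar n - sigma nbar (n - 1))
    have h3 := hasDerivAt_norm_sq_displacement (Finsupp.single n 1) n 0
    simp only [toFock_single, one_smul] at h3
    have h4 := ((h1.add h2).add ((h3.const_sub 1).const_mul 2)).const_mul 2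
    refine h4.congr_deriv ?_
    have h5 : current (ket n) n - current (ket n) (n + 1) = 0 := by
      rcases n with _ | n <;> simp [current, ket_apply]
    rw [h0, h5, hκ]
    ring
  obtain ⟨η, hη0, hη1, hη⟩ : ∃ η : ℝ, 0 < η ∧ η ≤ 1 ∧ ∀ a ∈ Set.Icc 0 η, Φ a ≤ κ * a := by
    have := hΦd.isLittleO.bound (neg_pos.mpr hneg)
    obtain ⟨η, hη, hb⟩ := Metric.eventually_nhds_iff.mp this
    refine ⟨min 1 (η / 2), by positivity, min_le_left _ _, fun a ha => ?_⟩
    have h1 : a < η := by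
      have := ha.2.trans (min_le_right _ _); linarith
    have h2 := hb (y := a) (by rw [Real.dist_eq, sub_zero, abs_of_nonneg ha.1]; exact h1)
    rw [hΦ0, sub_zero, sub_zero, smul_eq_mul, Real.norm_eq_abs, Real.norm_eq_abs,
      abs_of_nonneg ha.1] at h2
    have h3 := (le_abs_self _).trans h2
    linarith
  refine ⟨η, ⟨by linarith, hη1⟩, ?_⟩
  have hR : ∀ R, n < R → cutoff nbar R (displacement η (ket n)) - cutoff nbar R (ket n)
      ≤ κ * η ^ 2 / 2 := fun R hR => by
    have hd : ∀ a, HasDerivAt (fun a => cutoff nbar R (y a) - κ * a ^ 2 / 2)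
        (2 * ∑ m ∈ Finset.range R, (sigma nbar (m + 1) - sigma nbar m)
          * current (y a) (m + 1) - κ * a) a := fun a => by
      have h1 := hasDerivAt_cutoff_displacement nbar R (Finsupp.single n 1) a
      simp only [toFock_single, one_smul] at h1
      have h2 := ((hasDerivAt_pow 2 a).const_mul κ).div_const 2
      refine (h1.sub h2).congr_deriv ?_
      simp only [hy]
      push_cast
      ring
    have hanti : AntitoneOn (fun a => cutoff nbar R (y a) - κ * a ^ 2 / 2) (Set.Icc 0 η) := by
      refine antitoneOn_of_deriv_nonpos (convex_Icc _ _)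
        (fun a _ => (hd a).continuousAt.continuousWithinAt)
        (fun a _ => (hd a).differentiableAt.differentiableWithinAt) fun a ha => ?_
      rw [(hd a).deriv]
      rw [interior_Icc] at ha
      have h1 := sum_current_le (nbar := nbar) hR (y a)
      have h2 := hη a ⟨ha.1.le, ha.2.le⟩
      have h3 : ‖y a‖ ^ 2 = 1 := by rw [hy]; simp [norm_ket]
      rw [h3] at h1
      simp only [hΦ] at h2
      linarith
    have := hanti (Set.left_mem_Icc.mpr hη0.le) (Set.right_mem_Icc.mpr hη0.le) hη0.le
    simp only [hy, h0] at this
    linarith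
  have hle : energyGain nbar η (ket n) ≤ κ * η ^ 2 / 2 := by
    refine le_of_tendsto (tendsto_energyGain nbar η (ket n)) ?_
    filter_upwards [eventually_gt_atTop n] with R h using hR R h
  have : κ * η ^ 2 / 2 < 0 := by
    have : 0 < η ^ 2 := by positivity
    nlinarith
  linarith

/-! ### Measurements -/

theorem hasSum_norm_sq_diagonalOp (c : ℕ → ℝ) (hc : ∀ n, |c n| ≤ 1) (x : Fock) :
    HasSum (fun n => c n ^ 2 * ‖x n‖ ^ 2) (‖diagonalOp c hc x‖ ^ 2) := by
  refine (hasSum_norm_sq (diagonalOp c hc x)).congr_fun fun n => ?_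
  rw [diagonalOp_apply, norm_mul, mul_pow, Complex.norm_real, Real.norm_eq_abs, sq_abs]

theorem hasSum_norm_sq_measG (θ φ : ℝ) (x : Fock) :
    HasSum (fun n : ℕ => Real.cos (θ + n * φ) ^ 2 * ‖x n‖ ^ 2) (‖measG θ φ x‖ ^ 2) :=
  hasSum_norm_sq_diagonalOp _ _ x

theorem norm_measG_apply (θ φ : ℝ) (x : Fock) (n : ℕ) :
    ‖measG θ φ x n‖ ^ 2 = Real.cos (θ + n * φ) ^ 2 * ‖x n‖ ^ 2 := by
  rw [measG, diagonalOp_apply, norm_mul, mul_pow, Complex.norm_real, Real.norm_eq_abs, sq_abs]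

theorem norm_measE_apply (θ φ : ℝ) (x : Fock) (n : ℕ) :
    ‖measE θ φ x n‖ ^ 2 = Real.sin (θ + n * φ) ^ 2 * ‖x n‖ ^ 2 := by
  rw [measE, diagonalOp_apply, norm_mul, mul_pow, Complex.norm_real, Real.norm_eq_abs, sq_abs]

theorem measG_measE_comm (θ φ : ℝ) (x : Fock) :
    measG θ φ (measE θ φ x) = measE θ φ (measG θ φ x) := by
  ext n
  simp only [measG, measE, diagonalOp_apply]
  ring

theorem measG_ket (θ φ : ℝ) (n : ℕ) :
    measG θ φ (ket n) = ((Real.cos (θ + n * φ) : ℝ) : ℂ) • ket n := by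
  ext m
  rw [measG, diagonalOp_apply, lp.coeFn_smul, Pi.smul_apply, ket_apply, smul_eq_mul]
  split_ifs with h
  · rw [h]
  · simp

theorem measE_ket (θ φ : ℝ) (n : ℕ) :
    measE θ φ (ket n) = ((Real.sin (θ + n * φ) : ℝ) : ℂ) • ket n := by
  ext m
  rw [measE, diagonalOp_apply, lp.coeFn_smul, Pi.smul_apply, ket_apply, smul_eq_mul]
  split_ifs with h
  · rw [h]
  · simp

theorem ket_ne_zero (n : ℕ) : ket n ≠ 0 := norm_ne_zero_iff.mp (by rw [norm_ket]; exact one_ne_zero)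

theorem eq_of_mem_eigenspace {T : Fock →L[ℂ] Fock} (hT : NondegenerateEigenvalues T) {z : ℂ}
    {m n : ℕ} (hm : T (ket m) = z • ket m) (hn : T (ket n) = z • ket n) : m = n := by
  obtain ⟨v, hv⟩ := rank_le_one_iff.mp (hT z)
  obtain ⟨r, hr⟩ := hv ⟨ket m, Module.End.mem_eigenspace_iff.mpr hm⟩
  obtain ⟨s, hs⟩ := hv ⟨ket n, Module.End.mem_eigenspace_iff.mpr hn⟩
  replace hr : r • (v : Fock) = ket m := congrArg Subtype.val hr
  replace hs : s • (v : Fock) = ket n := congrArg Subtype.val hs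
  by_contra h
  have h1 : r * (v : Fock) m = 1 := by
    rw [← smul_eq_mul, ← Pi.smul_apply, ← lp.coeFn_smul, hr, ket_apply, if_pos rfl]
  have h2 : s * (v : Fock) m = 0 := by
    rw [← smul_eq_mul, ← Pi.smul_apply, ← lp.coeFn_smul, hs, ket_apply, if_neg h]
  have h3 : s = 0 := (mul_eq_zero.mp h2).resolve_right (right_ne_zero_of_mul_eq_one h1)
  rw [h3, zero_smul] at hs
  exact ket_ne_zero n hs.symm

/-- Under the non-degeneracy assumption, the outcome probabilities separate the Fock states: if the
cosine and the sine both changed sign from `m` to `n`, then they would agree at `m` and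
`n + (n - m)`. -/
theorem cos_sq_injective {θ φ : ℝ} (hg : NondegenerateEigenvalues (measG θ φ))
    (he : NondegenerateEigenvalues (measE θ φ)) :
    Function.Injective fun n : ℕ => Real.cos (θ + n * φ) ^ 2 := by
  have hcos : ∀ {m n : ℕ}, Real.cos (θ + m * φ) = Real.cos (θ + n * φ) → m = n := fun {m n} h =>
    eq_of_mem_eigenspace hg (measG_ket θ φ m) (by rw [h, measG_ket])
  have hsin : ∀ {m n : ℕ}, Real.sin (θ + m * φ) = Real.sin (θ + n * φ) → m = n := fun {m n} h =>
    eq_of_mem_eigenspace he (measE_ket θ φ m) (by rw [h, measE_ket])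
  have key : ∀ m n : ℕ, m ≤ n → Real.cos (θ + m * φ) ^ 2 = Real.cos (θ + n * φ) ^ 2 → m = n := by
    intro m n hmn h
    have h' : Real.sin (θ + m * φ) ^ 2 = Real.sin (θ + n * φ) ^ 2 := by
      rw [Real.sin_sq, Real.sin_sq, h]
    rcases sq_eq_sq_iff_eq_or_eq_neg.mp h with hc | hc
    · exact hcos hc
    rcases sq_eq_sq_iff_eq_or_eq_neg.mp h' with hs | hs
    · exact hsin hs
    have hk : ((n + (n - m) : ℕ) : ℝ) = n + (n - m) := by push_cast [hmn]; ring
    set x := θ + m * φ with hx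
    set y := θ + n * φ with hy
    have e1 : θ + ((n + (n - m) : ℕ) : ℝ) * φ = y + (y - x) := by rw [hk, hx, hy]; ring
    have hd : Real.cos (y - x) = -1 := by
      rw [Real.cos_sub, hc, hs]
      nlinarith [Real.sin_sq_add_cos_sq y]
    have hd' : Real.sin (y - x) = 0 := by
      have := Real.sin_sq_add_cos_sq (y - x)
      rw [hd] at this
      nlinarith
    have := hcos (m := m) (n := n + (n - m))
      (by rw [e1, Real.cos_add y (y - x), hd, hd', ← hx, hc]; ring)
    omega
  intro m n h
  rcases le_total m n with hmn | hmn
  · exact key m n hmn h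
  · exact (key n m hmn h.symm).symm

theorem afterOutcome_of_ne_zero {M : Fock →L[ℂ] Fock} {ψ : State} (h : M ψ ≠ 0) :
    (afterOutcome M ψ : Fock) = ((‖M ψ‖⁻¹ : ℝ) : ℂ) • M ψ := by
  rw [afterOutcome, dif_neg h]

/-- A function that is homogeneous like a quadratic form can be averaged over the outcomes without
normalizing the states. -/
theorem norm_sq_mul_afterOutcome (M : Fock →L[ℂ] Fock) (ψ : State) {g : Fock → ℝ}
    (hg : ∀ (c : ℂ) (x : Fock), g (c • x) = ‖c‖ ^ 2 * g x) :
    ‖M ψ‖ ^ 2 * g (afterOutcome M ψ) = g (M ψ) := by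
  by_cases h : M ψ = 0
  · have h0 := hg 0 0
    rw [zero_smul, norm_zero] at h0
    rw [h, h0, norm_zero]
    simp
  · have hn := norm_ne_zero_iff.mpr h
    rw [afterOutcome_of_ne_zero h, hg, Complex.norm_real, norm_inv, norm_norm]
    field_simp

/-! ### The Lyapunov function -/

theorem energy_smul (nbar : ℕ) (c : ℂ) (x : Fock) :
    energy nbar (c • x) = ENNReal.ofReal (‖c‖ ^ 2) * energy nbar x := by
  rw [energy, energy, ← ENNReal.tsum_mul_left]
  refine tsum_congr fun n => ?_
  rw [← ENNReal.ofReal_mul (by positivity), lp.coeFn_smul, Pi.smul_apply, norm_smul]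
  congr 1
  ring

theorem ofReal_norm_sq_mul_energy_le (nbar : ℕ) (M : Fock →L[ℂ] Fock) (ψ : State) :
    ENNReal.ofReal (‖M ψ‖ ^ 2) * energy nbar (afterOutcome M ψ) ≤ energy nbar (M ψ) := by
  by_cases h : M ψ = 0
  · simp [h]
  · have hn := norm_ne_zero_iff.mpr h
    rw [afterOutcome_of_ne_zero h, energy_smul, ← mul_assoc, ← ENNReal.ofReal_mul (by positivity),
      Complex.norm_real, norm_inv, norm_norm, ← mul_pow, mul_inv_cancel₀ hn]
    simp

theorem energy_measG_add_energy_measE (θ φ : ℝ) (nbar : ℕ) (x : Fock) :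
    energy nbar (measG θ φ x) + energy nbar (measE θ φ x) = energy nbar x := by
  rw [energy, energy, ← ENNReal.tsum_add]
  refine tsum_congr fun n => ?_
  have h := sigma_nonneg nbar n
  rw [← ENNReal.ofReal_add (by positivity) (by positivity), norm_measG_apply, norm_measE_apply,
    ← mul_add, ← add_mul, Real.cos_sq_add_sin_sq, one_mul]

/-- The bounded part of the Lyapunov function. -/
noncomputable def contrast (θ φ : ℝ) (nbar : ℕ) (δ : ℝ) (x : Fock) : ℝ :=
  δ * (Real.cos (θ + nbar * φ) ^ 4 + Real.sin (θ + nbar * φ) ^ 4)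
    - δ * (‖measG θ φ x‖ ^ 4 + ‖measE θ φ x‖ ^ 4)

theorem lyapunov_eq (θ φ : ℝ) (nbar : ℕ) (δ : ℝ) (ψ : State) :
    lyapunov θ φ nbar δ ψ = (energy nbar ψ : EReal) + (contrast θ φ nbar δ ψ : EReal) := rfl

theorem continuous_contrast (θ φ : ℝ) (nbar : ℕ) (δ : ℝ) : Continuous (contrast θ φ nbar δ) := by
  unfold contrast
  fun_prop

theorem norm_sq_measE (θ φ : ℝ) (ψ : State) :
    ‖measE θ φ ψ‖ ^ 2 = 1 - ‖measG θ φ ψ‖ ^ 2 := by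
  have := norm_sq_measG_add_norm_sq_measE θ φ ψ
  rw [ψ.norm_eq] at this
  linarith

theorem norm_sq_measG_le_one (θ φ : ℝ) (ψ : State) : ‖measG θ φ ψ‖ ^ 2 ≤ 1 := by
  have := norm_sq_measE θ φ ψ
  have h := sq_nonneg ‖measE θ φ ψ‖
  linarith

theorem contrast_eq (θ φ : ℝ) (nbar : ℕ) (δ : ℝ) (ψ : State) :
    contrast θ φ nbar δ ψ = 2 * δ * ((Real.cos (θ + nbar * φ) ^ 2) ^ 2
      - Real.cos (θ + nbar * φ) ^ 2 - (‖measG θ φ ψ‖ ^ 2) ^ 2 + ‖measG θ φ ψ‖ ^ 2) := by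
  have h1 : Real.sin (θ + nbar * φ) ^ 4 = (1 - Real.cos (θ + nbar * φ) ^ 2) ^ 2 := by
    rw [← Real.sin_sq]; ring
  have h2 : ‖measE θ φ ψ‖ ^ 4 = (1 - ‖measG θ φ ψ‖ ^ 2) ^ 2 := by
    rw [← norm_sq_measE]; ring
  rw [contrast, h1, h2]
  ring

theorem abs_contrast_le (θ φ : ℝ) (nbar : ℕ) {δ : ℝ} (hδ : 0 ≤ δ) (ψ : State) :
    |contrast θ φ nbar δ ψ| ≤ δ / 2 := by
  have key : ∀ p : ℝ, 0 ≤ p → p ≤ 1 → -(1 / 4) ≤ p ^ 2 - p ∧ p ^ 2 - p ≤ 0 := fun p h0 h1 =>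
    ⟨by nlinarith [sq_nonneg (p - 1 / 2)], by nlinarith⟩
  obtain ⟨a1, a2⟩ := key _ (sq_nonneg _) (Real.cos_sq_le_one (θ + nbar * φ))
  obtain ⟨b1, b2⟩ := key _ (sq_nonneg _) (norm_sq_measG_le_one θ φ ψ)
  rw [contrast_eq, abs_le]
  constructor <;> nlinarith

/-- The bounded part of `V` is controlled by the weights off the target, so that `V ≥ 0`. -/
theorem lyapunov_nonneg (θ φ : ℝ) (nbar : ℕ) {δ s : ℝ} (hδ : 0 ≤ δ) (hδs : 2 * δ ≤ s)
    (hs : ∀ n, n ≠ nbar → s ≤ sigma nbar n) (ψ : State) : 0 ≤ lyapunov θ φ nbar δ ψ := by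
  obtain ⟨x, hx⟩ : ∃ x : Fock, x = (ψ : Fock) := ⟨_, rfl⟩
  set w := ‖x nbar‖ ^ 2 with hw
  set c := Real.cos (θ + nbar * φ) ^ 2 with hc
  set p := ‖measG θ φ x‖ ^ 2 with hp
  have hx1 : ‖x‖ ^ 2 = 1 := by rw [hx, ψ.norm_eq, one_pow]
  have hrest : HasSum (fun n => ‖x n‖ ^ 2 - if n = nbar then w else 0) (1 - w) := by
    rw [← hx1]; exact (hasSum_norm_sq x).sub (hasSum_ite_eq nbar w)
  have hrestc : HasSum (fun n : ℕ => Real.cos (θ + n * φ) ^ 2 * ‖x n‖ ^ 2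
      - if n = nbar then c * w else 0) (p - c * w) :=
    (hasSum_norm_sq_measG θ φ x).sub (hasSum_ite_eq nbar (c * w))
  have h0 : ∀ n, 0 ≤ ‖x n‖ ^ 2 - if n = nbar then w else 0 := fun n => by
    split_ifs with h
    · rw [h, hw, sub_self]
    · rw [sub_zero]; positivity
  have hw1 : 0 ≤ 1 - w := hrest.nonneg h0
  have hp1 : 0 ≤ p - c * w := hrestc.nonneg fun n => by
    split_ifs with h
    · rw [h, hw, sub_self]
    · rw [sub_zero]; positivity
  have hp2 : p - c * w ≤ 1 - w := hasSum_le (fun n => by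
    split_ifs with h
    · rw [h, hw, hc, sub_self, sub_self]
    · rw [sub_zero, sub_zero]
      exact mul_le_of_le_one_left (by positivity) (Real.cos_sq_le_one _)) hrestc hrest
  have hc0 : 0 ≤ c := sq_nonneg _
  have hc1 : c ≤ 1 := Real.cos_sq_le_one _
  have hp0 : 0 ≤ p := sq_nonneg _
  have hp1' : p ≤ 1 := by rw [hp, hx]; exact norm_sq_measG_le_one θ φ ψ
  have hcontrast : -(2 * δ * (1 - w)) ≤ contrast θ φ nbar δ ψ := by
    have hpc : |p - c| ≤ 1 - w := abs_le.mpr ⟨by nlinarith, by nlinarith⟩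
    have hpc' : |1 - p - c| ≤ 1 := abs_le.mpr ⟨by linarith, by linarith⟩
    have hprod : |(p - c) * (1 - p - c)| ≤ 1 - w := by
      rw [abs_mul]
      exact (mul_le_of_le_one_right (abs_nonneg _) hpc').trans hpc
    have := (abs_le.mp hprod).1
    rw [contrast_eq, ← hx]
    have e : c ^ 2 - c - p ^ 2 + p = (p - c) * (1 - p - c) := by ring
    rw [e]
    nlinarith
  have henergy : ENNReal.ofReal (2 * δ * (1 - w)) ≤ energy nbar x := by
    have hr := hrest.mul_left (2 * δ)
    rw [← hr.tsum_eq, ENNReal.ofReal_tsum_of_nonneg (fun n => mul_nonneg (by linarith) (h0 n))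
      hr.summable]
    refine ENNReal.tsum_le_tsum fun n => ENNReal.ofReal_le_ofReal ?_
    by_cases h : n = nbar
    · rw [if_pos h, h, hw, sub_self, mul_zero]
      exact mul_nonneg (sigma_nonneg _ _) (sq_nonneg _)
    · rw [if_neg h, sub_zero]
      exact mul_le_mul_of_nonneg_right (hδs.trans (hs n h)) (sq_nonneg _)
  rw [lyapunov_eq, ← hx]
  rw [← hx] at hcontrast
  have h1 : ((2 * δ * (1 - w) : ℝ) : EReal) ≤ (energy nbar x : EReal) := by
    have := EReal.coe_ennreal_le_coe_ennreal_iff.mpr henergy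
    rwa [EReal.coe_ennreal_ofReal, max_eq_left (by positivity)] at this
  refine le_trans ?_ (add_le_add h1 (EReal.coe_le_coe_iff.mpr hcontrast))
  rw [← EReal.coe_add, add_neg_cancel, EReal.coe_zero]

/-- `V + δ`, as a function with values in `[0, ∞]`. -/
noncomputable def shiftedLyapunov (θ φ : ℝ) (nbar : ℕ) (δ : ℝ) (x : Fock) : ℝ≥0∞ :=
  energy nbar x + ENNReal.ofReal (contrast θ φ nbar δ x + δ)

theorem contrast_add_nonneg (θ φ : ℝ) (nbar : ℕ) {δ : ℝ} (hδ : 0 ≤ δ) (ψ : State) :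
    0 ≤ contrast θ φ nbar δ ψ + δ := by
  have := (abs_le.mp (abs_contrast_le θ φ nbar hδ ψ)).1
  linarith

theorem coe_shiftedLyapunov (θ φ : ℝ) (nbar : ℕ) {δ : ℝ} (hδ : 0 ≤ δ) (ψ : State) :
    (shiftedLyapunov θ φ nbar δ ψ : EReal) = lyapunov θ φ nbar δ ψ + (δ : EReal) := by
  rw [shiftedLyapunov, lyapunov_eq, EReal.coe_ennreal_add, EReal.coe_ennreal_ofReal,
    max_eq_left (contrast_add_nonneg θ φ nbar hδ ψ), EReal.coe_add, add_assoc]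

theorem shiftedLyapunov_eq (θ φ : ℝ) (nbar : ℕ) {δ : ℝ} (hδ : 0 ≤ δ) (ψ : State)
    (h : 0 ≤ lyapunov θ φ nbar δ ψ) :
    shiftedLyapunov θ φ nbar δ ψ = (lyapunov θ φ nbar δ ψ).toENNReal + ENNReal.ofReal δ := by
  have := congrArg EReal.toENNReal (coe_shiftedLyapunov θ φ nbar hδ ψ)
  rwa [EReal.toENNReal_coe, EReal.toENNReal_add h (EReal.coe_nonneg.mpr hδ),
    EReal.toENNReal_of_ne_top (EReal.coe_ne_top _), EReal.toReal_coe] at this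

theorem energy_le_shiftedLyapunov (θ φ : ℝ) (nbar : ℕ) (δ : ℝ) (x : Fock) :
    energy nbar x ≤ shiftedLyapunov θ φ nbar δ x := le_self_add

theorem measurable_shiftedLyapunov (θ φ : ℝ) (nbar : ℕ) (δ : ℝ) :
    Measurable (shiftedLyapunov θ φ nbar δ) := by
  refine Measurable.add (Measurable.tsum fun n => ?_) ?_
  · exact ((((continuous_coord n).norm.pow 2).const_mul _).measurable).ennreal_ofReal
  · exact ((continuous_contrast θ φ nbar δ).add_const δ).measurable.ennreal_ofReal

/-! ### Decrease of the Lyapunov function in one step -/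

/-- The variance of `cos² (θ + N φ)` in the state `ψ`. -/
noncomputable def spread (θ φ : ℝ) (x : Fock) : ℝ :=
  ‖measG θ φ (measG θ φ x)‖ ^ 2 - (‖measG θ φ x‖ ^ 2) ^ 2

theorem hasSum_spread (θ φ : ℝ) (ψ : State) :
    HasSum (fun n : ℕ => (Real.cos (θ + n * φ) ^ 2 - ‖measG θ φ ψ‖ ^ 2) ^ 2 * ‖(ψ : Fock) n‖ ^ 2)
      (spread θ φ ψ) := by
  set p := ‖measG θ φ ψ‖ ^ 2 with hp
  have h1 := hasSum_norm_sq_measG θ φ (measG θ φ ψ)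
  have h2 := (hasSum_norm_sq_measG θ φ ψ).mul_left (2 * p)
  have h3 := (hasSum_norm_sq (ψ : Fock)).mul_left (p ^ 2)
  rw [ψ.norm_eq] at h3
  have h := (h1.sub h2).add h3
  have e : spread θ φ ψ = ‖measG θ φ (measG θ φ ψ)‖ ^ 2 - 2 * p * ‖measG θ φ ψ‖ ^ 2
      + p ^ 2 * 1 ^ 2 := by rw [spread, ← hp]; ring
  rw [e]
  refine h.congr_fun fun n => ?_
  rw [norm_measG_apply]
  ring

/-- A state without spread is a Fock state, up to a phase. -/
theorem exists_mem_fockRay_of_spread_eq_zero {θ φ : ℝ}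
    (hinj : Function.Injective fun n : ℕ => Real.cos (θ + n * φ) ^ 2) {ψ : State}
    (h : spread θ φ ψ = 0) : ∃ n, ψ ∈ fockRay n := by
  have hs := hasSum_spread θ φ ψ
  rw [h, hasSum_zero_iff_of_nonneg fun n => by positivity] at hs
  have hcos : ∀ n, (ψ : Fock) n ≠ 0 → Real.cos (θ + n * φ) ^ 2 = ‖measG θ φ ψ‖ ^ 2 := fun n hn => by
    have h1 := congrFun hs n
    have h2 : ‖(ψ : Fock) n‖ ^ 2 ≠ 0 := by positivity
    have h3 := (mul_eq_zero.mp h1).resolve_right h2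
    exact sub_eq_zero.mp (pow_eq_zero_iff two_ne_zero |>.mp h3)
  have hne : (ψ : Fock) ≠ 0 := norm_ne_zero_iff.mp (by rw [ψ.norm_eq]; exact one_ne_zero)
  obtain ⟨n, hn⟩ : ∃ n, (ψ : Fock) n ≠ 0 := by
    by_contra! hall
    exact hne (lp.ext (funext hall))
  have hψ : (ψ : Fock) = (ψ : Fock) n • ket n := by
    ext m
    rw [lp.coeFn_smul, Pi.smul_apply, ket_apply, smul_eq_mul]
    split_ifs with hm
    · rw [hm, mul_one]
    · rw [mul_zero]
      by_contra hm0
      exact hm (hinj ((hcos m hm0).trans (hcos n hn).symm))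
  refine ⟨n, (ψ : Fock) n, ?_, hψ⟩
  have := congrArg norm hψ
  rw [norm_smul, norm_ket, mul_one, ψ.norm_eq] at this
  exact this.symm

/-- The measurement lowers the mean of the bounded part of `V` (Jensen's inequality, with the
variance of the posterior probability as defect). -/
theorem contrast_measurement (θ φ : ℝ) (nbar : ℕ) {δ : ℝ} (hδ : 0 ≤ δ) (ψ : State) :
    ‖measG θ φ ψ‖ ^ 2 * contrast θ φ nbar δ (afterOutcome (measG θ φ) ψ)
      + ‖measE θ φ ψ‖ ^ 2 * contrast θ φ nbar δ (afterOutcome (measE θ φ) ψ)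
      + 2 * δ * spread θ φ ψ ^ 2 ≤ contrast θ φ nbar δ ψ := by
  have hom : ∀ (c : ℂ) (x : Fock), ‖measG θ φ (c • x)‖ ^ 2 = ‖c‖ ^ 2 * ‖measG θ φ x‖ ^ 2 :=
    fun c x => by rw [map_smul, norm_smul, mul_pow]
  have hA := norm_sq_mul_afterOutcome (measG θ φ) ψ (g := fun x => ‖measG θ φ x‖ ^ 2) hom
  have hB := norm_sq_mul_afterOutcome (measE θ φ) ψ (g := fun x => ‖measG θ φ x‖ ^ 2) hom
  have h1 := norm_sq_measG_add_norm_sq_measE θ φ (measG θ φ ψ)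
  rw [← measG_measE_comm] at h1
  rw [norm_sq_measE] at hB ⊢
  rw [contrast_eq, contrast_eq, contrast_eq, spread]
  set p := ‖measG θ φ ψ‖ ^ 2 with hp
  set a := ‖measG θ φ (afterOutcome (measG θ φ) ψ)‖ ^ 2
  set b := ‖measG θ φ (afterOutcome (measE θ φ) ψ)‖ ^ 2
  have hp0 : 0 ≤ p := sq_nonneg _
  have hp1 : p ≤ 1 := norm_sq_measG_le_one θ φ ψ
  rw [← hA]
  rw [← hA, ← hB] at h1
  have e1 : (1 - p) * b = p - p * a := by linarith
  have h2 : (p * a - p ^ 2) ^ 2 ≤ p * (a - p) ^ 2 + (1 - p) * (b - p) ^ 2 := by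
    have h3 : 0 ≤ (1 - p) * (b - p) ^ 2 := mul_nonneg (by linarith) (sq_nonneg _)
    have h4 : 0 ≤ (1 - p) * (p * (a - p) ^ 2) :=
      mul_nonneg (by linarith) (mul_nonneg hp0 (sq_nonneg _))
    nlinarith
  have h5 : p * (a - p) ^ 2 + (1 - p) * (b - p) ^ 2 = p * a ^ 2 + (1 - p) * b ^ 2 - p ^ 2 := by
    linear_combination (-2 * p) * e1
  have h6 := mul_le_mul_of_nonneg_left (h2.trans h5.le) (by positivity : 0 ≤ 2 * δ)
  linear_combination h6 + 2 * δ * e1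

theorem displacement_zero (x : Fock) : displacement 0 x = x := by
  refine denseRange_toFock.induction_on (p := fun x => displacement 0 x = x) x
    (isClosed_eq (displacement 0).continuous continuous_id) displacement_zero_toFock

theorem displace_zero (ψ : State) : displace 0 ψ = ψ := Subtype.ext (displacement_zero _)

theorem lyapunov_displace (θ φ : ℝ) (nbar : ℕ) (δ α : ℝ) (ψ : State) :
    lyapunov θ φ nbar δ (displace α ψ) = (energy nbar ψ : EReal)
      + ((energyGain nbar α ψ + contrast θ φ nbar δ (displace α ψ) : ℝ) : EReal) := by
  rw [lyapunov_eq, EReal.coe_add, ← add_assoc, ← energy_displacement]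
  rfl

/-- A lower bound of the decrease of `V` under the displacement by `α` instead of no displacement,
made homogeneous like a quadratic form. -/
noncomputable def descent (nbar : ℕ) (δ α : ℝ) (x : Fock) : ℝ :=
  max 0 (-energyGain nbar α x - δ * ‖x‖ ^ 2)

theorem descent_nonneg (nbar : ℕ) (δ α : ℝ) (x : Fock) : 0 ≤ descent nbar δ α x := le_max_left _ _

theorem continuous_descent (nbar : ℕ) (δ α : ℝ) : Continuous (descent nbar δ α) := by
  have := continuous_energyGain nbar α
  unfold descent
  fun_prop

theorem descent_smul (nbar : ℕ) (δ α : ℝ) (c : ℂ) (x : Fock) :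
    descent nbar δ α (c • x) = ‖c‖ ^ 2 * descent nbar δ α x := by
  rw [descent, descent, energyGain_smul, norm_smul, mul_max_of_nonneg _ _ (sq_nonneg _), mul_zero]
  congr 1
  ring

theorem descent_le (nbar : ℕ) {δ α : ℝ} (hδ : 0 ≤ δ) (x : Fock) :
    descent nbar δ α x ≤ 4 * (‖x‖ ^ 2 * |α|) := by
  refine max_le (by positivity) ?_
  have h1 := (abs_le.mp (abs_energyGain_le nbar α x)).1
  have h2 : 0 ≤ δ * ‖x‖ ^ 2 := by positivity
  linarith

theorem shiftedLyapunov_feedback {θ φ : ℝ} {nbar : ℕ} {δ αbar : ℝ} (hδ : 0 ≤ δ) {u : State → ℝ}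
    (hu : IsArgminFeedback θ φ nbar δ αbar u) {α : ℝ} (hα : α ∈ Set.Icc (-αbar) αbar) (ψ : State) :
    shiftedLyapunov θ φ nbar δ (displace (u ψ) ψ) + ENNReal.ofReal (descent nbar δ α ψ)
      ≤ shiftedLyapunov θ φ nbar δ ψ := by
  have h0 : (0 : ℝ) ∈ Set.Icc (-αbar) αbar := by
    have := hα.1.trans hα.2
    constructor <;> linarith
  have key : lyapunov θ φ nbar δ (displace (u ψ) ψ)
      ≤ lyapunov θ φ nbar δ ψ + ((-descent nbar δ α ψ : ℝ) : EReal) := by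
    rcases le_total 0 (-energyGain nbar α ψ - δ * ‖(ψ : Fock)‖ ^ 2) with h | h
    · rw [descent, max_eq_right h]
      refine (hu.isMinOn ψ hα).trans ?_
      simp only [lyapunov_displace]
      rw [lyapunov_eq, add_assoc, ← EReal.coe_add]
      refine add_le_add le_rfl (EReal.coe_le_coe_iff.mpr ?_)
      have h1 := (abs_le.mp (abs_contrast_le θ φ nbar hδ ψ)).1
      have h2 := (abs_le.mp (abs_contrast_le θ φ nbar hδ (displace α ψ))).2
      rw [ψ.norm_eq]
      linarith
    · rw [descent, max_eq_left h, neg_zero, EReal.coe_zero, add_zero]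
      have := isMinOn_iff.mp (hu.isMinOn ψ) 0 h0
      rwa [displace_zero] at this
  rw [← EReal.coe_ennreal_le_coe_ennreal_iff, EReal.coe_ennreal_add, coe_shiftedLyapunov _ _ _ hδ,
    coe_shiftedLyapunov _ _ _ hδ, EReal.coe_ennreal_ofReal, max_eq_left (descent_nonneg _ _ _ _)]
  refine (add_le_add (add_le_add key le_rfl) le_rfl).trans (le_of_eq ?_)
  rw [add_assoc, add_assoc, ← EReal.coe_add, ← EReal.coe_add]
  congr 2
  ring

theorem shiftedLyapunov_measurement (θ φ : ℝ) (nbar : ℕ) {δ : ℝ} (hδ : 0 ≤ δ) (ψ : State) :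
    ENNReal.ofReal (‖measG θ φ ψ‖ ^ 2) * shiftedLyapunov θ φ nbar δ (afterOutcome (measG θ φ) ψ)
      + ENNReal.ofReal (‖measE θ φ ψ‖ ^ 2)
        * shiftedLyapunov θ φ nbar δ (afterOutcome (measE θ φ) ψ)
      + ENNReal.ofReal (2 * δ * spread θ φ ψ ^ 2) ≤ shiftedLyapunov θ φ nbar δ ψ := by
  have h1 := ofReal_norm_sq_mul_energy_le nbar (measG θ φ) ψ
  have h2 := ofReal_norm_sq_mul_energy_le nbar (measE θ φ) ψ
  have h3 := add_le_add h1 h2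
  rw [energy_measG_add_energy_measE] at h3
  have h4 := contrast_measurement θ φ nbar hδ ψ
  have h5 : ENNReal.ofReal (‖measG θ φ ψ‖ ^ 2)
        * ENNReal.ofReal (contrast θ φ nbar δ (afterOutcome (measG θ φ) ψ) + δ)
      + ENNReal.ofReal (‖measE θ φ ψ‖ ^ 2)
        * ENNReal.ofReal (contrast θ φ nbar δ (afterOutcome (measE θ φ) ψ) + δ)
      + ENNReal.ofReal (2 * δ * spread θ φ ψ ^ 2)
      ≤ ENNReal.ofReal (contrast θ φ nbar δ ψ + δ) := by
    have n1 := contrast_add_nonneg θ φ nbar hδ (afterOutcome (measG θ φ) ψ)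
    have n2 := contrast_add_nonneg θ φ nbar hδ (afterOutcome (measE θ φ) ψ)
    rw [← ENNReal.ofReal_mul (by positivity), ← ENNReal.ofReal_mul (by positivity),
      ← ENNReal.ofReal_add (by positivity) (by positivity),
      ← ENNReal.ofReal_add (by positivity) (by positivity)]
    refine ENNReal.ofReal_le_ofReal ?_
    have := norm_sq_measE θ φ ψ
    have e : ‖measG θ φ ψ‖ ^ 2 * δ + ‖measE θ φ ψ‖ ^ 2 * δ = δ := by rw [this]; ring
    linarith
  refine le_trans (le_of_eq ?_) (add_le_add h3 h5)
  simp only [shiftedLyapunov, mul_add]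
  ring

/-- A lower bound of the mean decrease of `V` in one step of the closed loop. -/
noncomputable def decrease (θ φ : ℝ) (nbar : ℕ) (δ α : ℝ) (x : Fock) : ℝ :=
  2 * δ * spread θ φ x ^ 2 + descent nbar δ α (measG θ φ x) + descent nbar δ α (measE θ φ x)

theorem continuous_decrease (θ φ : ℝ) (nbar : ℕ) (δ α : ℝ) :
    Continuous (decrease θ φ nbar δ α) := by
  have := continuous_descent nbar δ α
  unfold decrease spread
  fun_prop

theorem decrease_nonneg (θ φ : ℝ) (nbar : ℕ) {δ : ℝ} (hδ : 0 ≤ δ) (α : ℝ) (x : Fock) :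
    0 ≤ decrease θ φ nbar δ α x := by
  have h1 := descent_nonneg nbar δ α (measG θ φ x)
  have h2 := descent_nonneg nbar δ α (measE θ φ x)
  unfold decrease
  positivity

theorem decrease_le (θ φ : ℝ) (nbar : ℕ) {δ : ℝ} (hδ : 0 ≤ δ) (α : ℝ) (ψ : State) :
    decrease θ φ nbar δ α ψ ≤ 2 * δ + 4 * |α| := by
  have h1 := descent_le nbar (α := α) hδ (measG θ φ ψ)
  have h2 := descent_le nbar (α := α) hδ (measE θ φ ψ)
  rw [norm_sq_measE] at h2
  have h3 : spread θ φ ψ ^ 2 ≤ 1 := by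
    have a1 := norm_sq_measG_add_norm_sq_measE θ φ (measG θ φ ψ)
    have a2 := norm_sq_measG_le_one θ φ ψ
    have a3 := sq_nonneg ‖measE θ φ (measG θ φ ψ)‖
    have a4 : 0 ≤ spread θ φ ψ := (hasSum_spread θ φ ψ).nonneg fun n => by positivity
    have a5 : spread θ φ ψ ≤ 1 := by
      have : 0 ≤ (‖measG θ φ ψ‖ ^ 2) ^ 2 := by positivity
      rw [spread]; linarith
    nlinarith
  have h4 := mul_le_mul_of_nonneg_left h3 (by positivity : 0 ≤ 2 * δ)
  rw [decrease]
  linarith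

/-- One step of the closed loop lowers the mean of `V` by at least `decrease`, whichever `α` is
taken as a competitor of the argmin feedback. -/
theorem lintegral_transition_add_decrease_le {θ φ : ℝ} {nbar : ℕ} {δ αbar : ℝ} (hδ : 0 ≤ δ)
    {u : State → ℝ} (hu : IsArgminFeedback θ φ nbar δ αbar u) {α : ℝ}
    (hα : α ∈ Set.Icc (-αbar) αbar) (ψ : State) :
    ∫⁻ χ, shiftedLyapunov θ φ nbar δ χ ∂(transition θ φ u hu.measurable ψ)
        + ENNReal.ofReal (decrease θ φ nbar δ α ψ)
      ≤ shiftedLyapunov θ φ nbar δ ψ := by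
  have hm : Measurable fun χ : State => shiftedLyapunov θ φ nbar δ χ :=
    (measurable_shiftedLyapunov θ φ nbar δ).comp measurable_subtype_coe
  have e : ∫⁻ χ, shiftedLyapunov θ φ nbar δ χ ∂(transition θ φ u hu.measurable ψ)
      = ENNReal.ofReal (‖measG θ φ ψ‖ ^ 2) * shiftedLyapunov θ φ nbar δ
          (displace (u (afterOutcome (measG θ φ) ψ)) (afterOutcome (measG θ φ) ψ))
        + ENNReal.ofReal (‖measE θ φ ψ‖ ^ 2) * shiftedLyapunov θ φ nbar δ
          (displace (u (afterOutcome (measE θ φ) ψ)) (afterOutcome (measE θ φ) ψ)) := by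
    rw [transition, Kernel.coe_mk, lintegral_add_measure, lintegral_smul_measure,
      lintegral_smul_measure, lintegral_dirac' _ hm, lintegral_dirac' _ hm]
    rfl
  have hd : ∀ M : Fock →L[ℂ] Fock, ENNReal.ofReal (descent nbar δ α (M ψ))
      = ENNReal.ofReal (‖M ψ‖ ^ 2) * ENNReal.ofReal (descent nbar δ α (afterOutcome M ψ)) :=
    fun M => by
      rw [← ENNReal.ofReal_mul (by positivity),
        norm_sq_mul_afterOutcome M ψ (descent_smul nbar δ α)]
  have h1 := shiftedLyapunov_feedback hδ hu hα (afterOutcome (measG θ φ) ψ)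
  have h2 := shiftedLyapunov_feedback hδ hu hα (afterOutcome (measE θ φ) ψ)
  refine le_trans ?_ (shiftedLyapunov_measurement θ φ nbar hδ ψ)
  refine le_trans (le_of_eq ?_) (add_le_add (add_le_add (mul_le_mul_right h1 _)
    (mul_le_mul_right h2 _)) le_rfl)
  have n1 := descent_nonneg nbar δ α (measG θ φ ψ)
  have n2 := descent_nonneg nbar δ α (measE θ φ ψ)
  rw [e, decrease, ENNReal.ofReal_add (by positivity) n2, ENNReal.ofReal_add (by positivity) n1,
    hd, hd]
  ring

/-! ### Existence of an argmin feedback -/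

/-- Measurable selection of a minimizer on an interval: the smallest one. -/
theorem exists_measurable_isMinOn {X : Type*} [MeasurableSpace X] {H : ℝ → X → ℝ} {a b : ℝ}
    (hab : a ≤ b) (hc : ∀ x, Continuous fun α => H α x) (hm : ∀ α, Measurable (H α)) :
    ∃ u : X → ℝ, Measurable u ∧ (∀ x, u x ∈ Set.Icc a b) ∧
      ∀ x, IsMinOn (fun α => H α x) (Set.Icc a b) (u x) := by
  set S : X → Set ℝ := fun x => {α | α ∈ Set.Icc a b ∧ ∀ β ∈ Set.Icc a b, H α x ≤ H β x} with hS
  have hScl : ∀ x, IsClosed (S x) := fun x => by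
    have e : S x = Set.Icc a b ∩ ⋂ β ∈ Set.Icc a b, {α | H α x ≤ H β x} := by
      ext α; simp [hS]
    rw [e]
    exact isClosed_Icc.inter (isClosed_biInter fun β _ => isClosed_le (hc x) continuous_const)
  have hSne : ∀ x, (S x).Nonempty := fun x => by
    obtain ⟨α, hα, hmin⟩ := isCompact_Icc.exists_isMinOn (Set.nonempty_Icc.mpr hab)
      (hc x).continuousOn
    exact ⟨α, hα, fun β hβ => hmin hβ⟩
  have hSc : ∀ x, IsCompact (S x) := fun x =>
    isCompact_Icc.of_isClosed_subset (hScl x) fun α hα => hα.1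
  have hu : ∀ x, sInf (S x) ∈ S x := fun x => (hSc x).sInf_mem (hSne x)
  refine ⟨fun x => sInf (S x), measurable_of_Iic fun c => ?_, fun x => (hu x).1,
    fun x β hβ => (hu x).2 β hβ⟩
  rcases lt_or_ge c a with hca | hca
  · have : (fun x => sInf (S x)) ⁻¹' Set.Iic c = ∅ := by
      ext x
      simpa using hca.trans_le (hu x).1.1
    rw [this]
    exact MeasurableSet.empty
  have hac : a ≤ min c b := le_min hca hab
  have : Nonempty (Set.Icc a b) := ⟨⟨a, le_rfl, hab⟩⟩
  have : Nonempty (Set.Icc a (min c b)) := ⟨⟨a, le_rfl, hac⟩⟩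
  set d : ℕ → Set.Icc a b := TopologicalSpace.denseSeq _
  set d' : ℕ → Set.Icc a (min c b) := TopologicalSpace.denseSeq _
  have hd : DenseRange d := TopologicalSpace.denseRange_denseSeq _
  have hd' : DenseRange d' := TopologicalSpace.denseRange_denseSeq _
  -- Both minima, over `[a, b]` and over `[a, c]`, are infima over countable dense sets.
  have e : (fun x => sInf (S x)) ⁻¹' Set.Iic c
      = ⋂ (i : ℕ) (k : ℕ), ⋃ j : ℕ, {x | H (d' j) x < H (d i) x + 1 / ((k : ℝ) + 1)} := by
    ext x
    simp only [Set.mem_preimage, Set.mem_Iic, Set.mem_iInter, Set.mem_iUnion, Set.mem_ofPred_eq]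
    constructor
    · intro h i k
      have h1 := (hu x).2 (d i) (d i).2
      have hk : (0 : ℝ) < 1 / ((k : ℝ) + 1) := by positivity
      exact hd'.exists_mem_open
        (s := {α : Set.Icc a (min c b) | H α x < H (d i) x + 1 / ((k : ℝ) + 1)})
        (isOpen_lt ((hc x).comp continuous_subtype_val) continuous_const)
        ⟨⟨sInf (S x), (hu x).1.1, le_min h (hu x).1.2⟩, by
          change H (sInf (S x)) x < _; linarith⟩
    · intro h
      obtain ⟨α, hα, hmin⟩ := isCompact_Icc.exists_isMinOn (Set.nonempty_Icc.mpr hac)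
        (hc x).continuousOn
      have hαS : α ∈ S x := by
        refine ⟨⟨hα.1, hα.2.trans (min_le_right _ _)⟩, fun β hβ => ?_⟩
        by_contra! hlt
        obtain ⟨i, hi⟩ := hd.exists_mem_open (s := {β : Set.Icc a b | H β x < H α x})
          (isOpen_lt ((hc x).comp continuous_subtype_val) continuous_const) ⟨⟨β, hβ⟩, hlt⟩
        obtain ⟨k, hk⟩ := exists_nat_one_div_lt (sub_pos.mpr (show H (d i) x < H α x from hi))
        obtain ⟨j, hj⟩ := h i k
        have := isMinOn_iff.mp hmin (d' j) (d' j).2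
        linarith
      exact (csInf_le (hSc x).bddBelow hαS).trans (hα.2.trans (min_le_left _ _))
  rw [e]
  exact MeasurableSet.iInter fun i => MeasurableSet.iInter fun k => MeasurableSet.iUnion fun j =>
    measurableSet_lt (hm _) ((hm _).add_const _)

/-- Up to the constant `∑ σ_n |ψ n|²`, finite or not, `α ↦ V (D_α ψ)` is a continuous real
function, so that a measurable selection of minimizers exists. -/
theorem exists_isArgminFeedback (θ φ : ℝ) (nbar : ℕ) (δ : ℝ) {αbar : ℝ} (hα : 0 ≤ αbar) :
    ∃ u : State → ℝ, IsArgminFeedback θ φ nbar δ αbar u := by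
  obtain ⟨u, hu, hmem, hmin⟩ := exists_measurable_isMinOn (a := -αbar) (b := αbar)
    (H := fun α (ψ : State) => energyGain nbar α ψ + contrast θ φ nbar δ (displace α ψ))
    (by linarith)
    (fun ψ => (continuous_energyGain_left nbar ψ).add ((continuous_contrast θ φ nbar δ).comp
      (continuous_subtype_val.comp (continuous_displace_left ψ))))
    (fun α => (((continuous_energyGain nbar α).comp continuous_subtype_val).add
      ((continuous_contrast θ φ nbar δ).comp
        (continuous_subtype_val.comp (continuous_displace α)))).measurable)
  refine ⟨u, hu, hmem, fun ψ => isMinOn_iff.mpr fun α h => ?_⟩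
  rw [lyapunov_displace, lyapunov_displace]
  exact add_le_add le_rfl (EReal.coe_le_coe_iff.mpr (isMinOn_iff.mp (hmin ψ) α h))

/-! ### Compactness -/

instance instSeparableSpaceFock : TopologicalSpace.SeparableSpace Fock := by
  have h1 : TopologicalSpace.IsSeparable (Set.range toFock) := by
    have h := (Set.countable_range ket).isSeparable.span (R := ℂ)
    rwa [← Finsupp.range_linearCombination, LinearMap.coe_range] at h
  have h2 := h1.closure
  rw [denseRange_toFock.closure_range] at h2
  exact TopologicalSpace.isSeparable_univ_iff.mp h2

instance instSecondCountableTopologyFock : SecondCountableTopology Fock :=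
  UniformSpace.secondCountable_of_separable Fock

theorem norm_sq_sub_le (x y : Fock) (R : ℕ) :
    ‖x - y‖ ^ 2 ≤ ∑ n ∈ Finset.range R, ‖x n - y n‖ ^ 2
      + 2 * (‖x‖ ^ 2 - ∑ n ∈ Finset.range R, ‖x n‖ ^ 2)
      + 2 * (‖y‖ ^ 2 - ∑ n ∈ Finset.range R, ‖y n‖ ^ 2) := by
  have h := hasSum_le (fun n => ?_) (hasSum_tail (x - y) R)
    (((hasSum_tail x R).mul_left 2).add ((hasSum_tail y R).mul_left 2))
  · simp only [lp.coeFn_sub, Pi.sub_apply] at h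
    linarith
  · rw [lp.coeFn_sub, Pi.sub_apply]
    have h1 := norm_sub_le (x (n + R)) (y (n + R))
    have h2 := pow_le_pow_left₀ (norm_nonneg _) h1 2
    nlinarith [sq_nonneg (‖x (n + R)‖ - ‖y (n + R)‖)]

theorem sigma_mul_tail_le {nbar R : ℕ} (h : nbar ≤ R) {L : ℝ} (hL : 0 ≤ L) {x : Fock}
    (hx : energy nbar x ≤ ENNReal.ofReal L) :
    sigma nbar R * (‖x‖ ^ 2 - ∑ n ∈ Finset.range R, ‖x n‖ ^ 2) ≤ L := by
  have h1 := (ENNReal.ofReal_le_ofReal_iff hL).mp ((ofReal_cutoff_le_energy h x).trans hx)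
  have h2 : 0 ≤ ∑ n ∈ Finset.range R, sigma nbar n * ‖x n‖ ^ 2 :=
    Finset.sum_nonneg fun n _ => mul_nonneg (sigma_nonneg nbar n) (sq_nonneg _)
  rw [cutoff_eq] at h1
  linarith

/-- As the weights tend to infinity, the states of bounded weighted photon number have uniformly
small tails. -/
theorem totallyBounded_energy_le (nbar : ℕ) {L : ℝ} (hL : 0 ≤ L) :
    TotallyBounded {ψ : State | energy nbar ψ ≤ ENNReal.ofReal L} := by
  refine Metric.totallyBounded_of_finite_discretization fun ε hε => ?_
  obtain ⟨R, hR, hRL⟩ : ∃ R, nbar ≤ R ∧ 16 * L / ε ^ 2 < sigma nbar R :=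
    ((eventually_ge_atTop nbar).and ((tendsto_sigma nbar).eventually_gt_atTop _)).exists
  have hσ : 0 < sigma nbar R := lt_of_le_of_lt (by positivity) hRL
  set η := ε / (2 * ((R : ℝ) + 1)) with hη
  have hη0 : 0 < η := by positivity
  obtain ⟨t, ht, hcov⟩ := Metric.totallyBounded_iff.mp
    (isCompact_closedBall (0 : Fin R → ℂ) 1).totallyBounded (η / 2) (by positivity)
  have hnear : ∀ ψ : State, ∃ c : t, dist (fun i : Fin R => (ψ : Fock) i) c < η / 2 := fun ψ => by
    have h1 : (fun i : Fin R => (ψ : Fock) i) ∈ Metric.closedBall (0 : Fin R → ℂ) 1 := by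
      rw [mem_closedBall_zero_iff, pi_norm_le_iff_of_nonneg zero_le_one]
      exact fun i => (lp.norm_apply_le_norm (by norm_num) _ _).trans ψ.norm_eq.le
    obtain ⟨c, hc, hd⟩ := Set.mem_iUnion₂.mp (hcov h1)
    exact ⟨⟨c, hc⟩, hd⟩
  choose F hF using hnear
  have := ht.fintype
  refine ⟨t, inferInstance, fun ψ => F ψ, fun ψ χ hψχ => ?_⟩
  have hd : dist (fun i : Fin R => (ψ.1 : Fock) i) (fun i : Fin R => (χ.1 : Fock) i) < η := by
    have h1 := hF ψ.1
    have h2 := hF χ.1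
    rw [← show F ψ.1 = F χ.1 from hψχ] at h2
    have := dist_triangle_right (fun i : Fin R => (ψ.1 : Fock) i)
      (fun i : Fin R => (χ.1 : Fock) i) (F ψ.1)
    linarith
  have hsum : ∑ n ∈ Finset.range R, ‖(ψ.1 : Fock) n - (χ.1 : Fock) n‖ ^ 2 ≤ R * η ^ 2 := by
    have h1 : ∀ n ∈ Finset.range R, ‖(ψ.1 : Fock) n - (χ.1 : Fock) n‖ ^ 2 ≤ η ^ 2 := fun n hn => by
      rw [← dist_eq_norm]
      have := dist_le_pi_dist (fun i : Fin R => (ψ.1 : Fock) i) (fun i : Fin R => (χ.1 : Fock) i)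
        ⟨n, Finset.mem_range.mp hn⟩
      exact pow_le_pow_left₀ dist_nonneg (this.trans hd.le) 2
    simpa using Finset.sum_le_card_nsmul _ _ _ h1
  have hsmall : R * η ^ 2 < ε ^ 2 / 2 := by
    rw [hη, div_pow, mul_div_assoc', div_lt_div_iff₀ (by positivity) two_pos]
    nlinarith [Nat.cast_nonneg (α := ℝ) R, sq_pos_of_pos hε, mul_nonneg (Nat.cast_nonneg (α := ℝ) R)
      (sq_pos_of_pos hε).le, mul_nonneg (sq_nonneg (R : ℝ)) (sq_pos_of_pos hε).le]
  have htail : ∀ ω : State, energy nbar ω ≤ ENNReal.ofReal L →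
      ‖(ω : Fock)‖ ^ 2 - ∑ n ∈ Finset.range R, ‖(ω : Fock) n‖ ^ 2 ≤ ε ^ 2 / 16 := fun ω hω => by
    have h1 := sigma_mul_tail_le hR hL hω
    rw [div_lt_iff₀ (by positivity)] at hRL
    by_contra! hlt
    have := mul_lt_mul_of_pos_left hlt hσ
    linarith
  have hle := norm_sq_sub_le (ψ.1 : Fock) (χ.1 : Fock) R
  have h1 := htail ψ.1 ψ.2
  have h2 := htail χ.1 χ.2
  have hlt : ‖(ψ.1 : Fock) - (χ.1 : Fock)‖ ^ 2 < ε ^ 2 := by nlinarith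
  have := lt_of_pow_lt_pow_left₀ 2 hε.le hlt
  rwa [← dist_eq_norm] at this

/-- Markov's inequality and the relative compactness of the sublevel sets of `Q` give tightness. -/
theorem isTightMeasureSet_of_lintegral_energy_le (nbar : ℕ) {B : ℝ≥0∞} (hB : B ≠ ⊤)
    {S : Set (Measure State)} (hS : ∀ ν ∈ S, ∫⁻ ψ, energy nbar ψ ∂ν ≤ B) :
    IsTightMeasureSet S := by
  rw [isTightMeasureSet_iff_exists_isCompact_measure_compl_le]
  intro ε hε
  obtain ⟨L, hL0, hL⟩ : ∃ L : ℝ, 0 < L ∧ B / ENNReal.ofReal L ≤ ε := by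
    have h1 : Tendsto (fun L : ℝ => B / ENNReal.ofReal L) atTop (𝓝 (B / ⊤)) :=
      ENNReal.Tendsto.const_div ENNReal.tendsto_ofReal_atTop (Or.inr hB)
    rw [ENNReal.div_top] at h1
    obtain ⟨L, h2, h3⟩ := ((h1.eventually_lt_const hε).and (eventually_gt_atTop 0)).exists
    exact ⟨L, h3, h2.le⟩
  have : CompleteSpace State := Metric.isClosed_sphere.completeSpace_coe
  refine ⟨closure {ψ : State | energy nbar ψ ≤ ENNReal.ofReal L},
    (totallyBounded_energy_le nbar hL0.le).closure.isCompact_of_isClosed isClosed_closure,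
    fun ν hν => ?_⟩
  have hm : Measurable fun ψ : State => energy nbar ψ :=
    (Measurable.tsum fun n => ((((continuous_coord n).norm.pow 2).const_mul
      _).measurable).ennreal_ofReal).comp measurable_subtype_coe
  calc ν (closure {ψ : State | energy nbar ψ ≤ ENNReal.ofReal L})ᶜ
      ≤ ν {ψ : State | ENNReal.ofReal L ≤ energy nbar ψ} := by
        refine measure_mono fun ψ hψ => ?_
        by_contra h
        exact hψ (subset_closure (show energy nbar ψ ≤ _ from le_of_lt (not_le.mp h)))
    _ ≤ (∫⁻ ψ, energy nbar ψ ∂ν) / ENNReal.ofReal L :=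
        meas_ge_le_lintegral_div hm.aemeasurable (by simpa using hL0) ENNReal.ofReal_ne_top
    _ ≤ B / ENNReal.ofReal L := by gcongr; exact hS ν hν
    _ ≤ ε := hL

/-- A sequence in a compact set has a limit point, and it converges to the set of all its limit
points. -/
theorem tendsto_nhdsSet_limitPoints {X : Type*} [TopologicalSpace X] [FirstCountableTopology X]
    {K : Set X} (hK : IsCompact K) {Γ : ℕ → X} (hΓ : ∀ k, Γ k ∈ K) :
    {a | ∃ l : ℕ → ℕ, StrictMono l ∧ Tendsto (fun j => Γ (l j)) atTop (𝓝 a)}.Nonempty ∧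
      Tendsto Γ atTop
        (𝓝ˢ {a | ∃ l : ℕ → ℕ, StrictMono l ∧ Tendsto (fun j => Γ (l j)) atTop (𝓝 a)}) := by
  constructor
  · obtain ⟨a, -, l, hl, ha⟩ := hK.tendsto_subseq hΓ
    exact ⟨a, l, hl, ha⟩
  · by_contra h
    obtain ⟨U, hU, hf⟩ := not_tendsto_iff_exists_frequently_notMem.mp h
    obtain ⟨l, hl, hlU⟩ := extraction_of_frequently_atTop hf
    obtain ⟨a, -, l', hl', ha⟩ := hK.tendsto_subseq fun j => hΓ (l j)
    have haU : U ∈ 𝓝 a := mem_nhdsSet_iff_forall.mp hU a ⟨l ∘ l', hl.comp hl', ha⟩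
    obtain ⟨j, hj⟩ := (ha.eventually haU).exists
    exact hlU (l' j) hj

/-! ### Limits of the closed loop -/

theorem tendsto_lintegral_ofReal {μs : ℕ → ProbabilityMeasure State} {ν : ProbabilityMeasure State}
    (h : Tendsto μs atTop (𝓝 ν)) {f : State → ℝ} (hf : Continuous f) {B : ℝ}
    (hB : ∀ x, f x ∈ Set.Icc 0 B) :
    Tendsto (fun k => ∫⁻ x, ENNReal.ofReal (f x) ∂(μs k : Measure State)) atTop
      (𝓝 (∫⁻ x, ENNReal.ofReal (f x) ∂(ν : Measure State))) := by
  have hc : Continuous fun x => (f x).toNNReal := continuous_real_toNNReal.comp hf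
  set F : BoundedContinuousFunction State NNReal :=
    BoundedContinuousFunction.mkOfBound ⟨_, hc⟩ B fun x y => by
      change dist (f x).toNNReal (f y).toNNReal ≤ B
      rw [NNReal.dist_eq, Real.coe_toNNReal _ (hB x).1, Real.coe_toNNReal _ (hB y).1, abs_le]
      constructor <;> linarith [(hB x).1, (hB x).2, (hB y).1, (hB y).2]
  exact ProbabilityMeasure.tendsto_iff_forall_lintegral_tendsto.mp h F

theorem tendsto_zero_of_add_le {a d : ℕ → ℝ≥0∞} (h0 : a 0 ≠ ⊤) (h : ∀ k, a (k + 1) + d k ≤ a k) :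
    Tendsto d atTop (𝓝 0) := by
  refine ENNReal.tendsto_atTop_zero_of_tsum_ne_top (ne_top_of_le_ne_top h0 ?_)
  refine ENNReal.tsum_le_of_sum_range_le fun n => le_trans ?_
    (?_ : a n + ∑ k ∈ Finset.range n, d k ≤ a 0)
  · exact le_add_self
  · induction n with
    | zero => simp
    | succ n ih =>
      refine le_trans ?_ ih
      rw [Finset.sum_range_succ, add_comm _ (d n), ← add_assoc]
      exact add_le_add (h n) le_rfl

theorem lintegral_law_succ (θ φ : ℝ) (u : State → ℝ) (hu : Measurable u)
    (μ : ProbabilityMeasure State) (k : ℕ) {f : State → ℝ≥0∞} (hf : Measurable f) :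
    ∫⁻ ψ, f ψ ∂(law θ φ u hu μ (k + 1) : Measure State)
      = ∫⁻ ψ, ∫⁻ χ, f χ ∂(transition θ φ u hu ψ) ∂(law θ φ u hu μ k : Measure State) :=
  Measure.lintegral_bind (Kernel.aemeasurable _) hf.aemeasurable

theorem lintegral_law_add_decrease_le {θ φ : ℝ} {nbar : ℕ} {δ αbar : ℝ} (hδ : 0 ≤ δ)
    {u : State → ℝ} (hu : IsArgminFeedback θ φ nbar δ αbar u) {α : ℝ}
    (hα : α ∈ Set.Icc (-αbar) αbar) (μ : ProbabilityMeasure State) (k : ℕ) :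
    ∫⁻ ψ, shiftedLyapunov θ φ nbar δ ψ ∂(law θ φ u hu.measurable μ (k + 1) : Measure State)
        + ∫⁻ ψ, ENNReal.ofReal (decrease θ φ nbar δ α ψ)
          ∂(law θ φ u hu.measurable μ k : Measure State)
      ≤ ∫⁻ ψ, shiftedLyapunov θ φ nbar δ ψ ∂(law θ φ u hu.measurable μ k : Measure State) := by
  have hm : Measurable fun χ : State => shiftedLyapunov θ φ nbar δ χ :=
    (measurable_shiftedLyapunov θ φ nbar δ).comp measurable_subtype_coe
  rw [lintegral_law_succ _ _ _ _ _ _ hm, ← lintegral_add_right]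
  · exact lintegral_mono fun ψ => lintegral_transition_add_decrease_le hδ hu hα ψ
  · exact ((continuous_decrease θ φ nbar δ α).comp continuous_subtype_val).measurable.ennreal_ofReal

/-- The decreases along the chain are summable, so that their mean vanishes in the limit. -/
theorem ae_decrease_eq_zero {θ φ : ℝ} {nbar : ℕ} {δ αbar : ℝ} (hδ : 0 ≤ δ) {u : State → ℝ}
    (hu : IsArgminFeedback θ φ nbar δ αbar u) {α : ℝ} (hα : α ∈ Set.Icc (-αbar) αbar)
    {μ ν : ProbabilityMeasure State}
    (hμ : ∫⁻ ψ, shiftedLyapunov θ φ nbar δ ψ ∂(μ : Measure State) ≠ ⊤)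
    (hν : ν ∈ weakLimitPoints (law θ φ u hu.measurable μ)) :
    ∀ᵐ ψ : State ∂(ν : Measure State), decrease θ φ nbar δ α (ψ : Fock) = 0 := by
  obtain ⟨l, hl, hlim⟩ := hν
  have hc : Continuous fun ψ : State => decrease θ φ nbar δ α ψ :=
    (continuous_decrease θ φ nbar δ α).comp continuous_subtype_val
  have h1 := tendsto_lintegral_ofReal hlim hc
    fun ψ => ⟨decrease_nonneg θ φ nbar hδ α ψ, decrease_le θ φ nbar hδ α ψ⟩
  have h2 := (tendsto_zero_of_add_le hμ
    (lintegral_law_add_decrease_le hδ hu hα μ)).comp hl.tendsto_atTop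
  have h3 := tendsto_nhds_unique h1 h2
  rw [lintegral_eq_zero_iff hc.measurable.ennreal_ofReal] at h3
  filter_upwards [h3] with ψ hψ
  exact le_antisymm (ENNReal.ofReal_eq_zero.mp hψ) (decrease_nonneg θ φ nbar hδ α ψ)

theorem lintegral_law_le {θ φ : ℝ} {nbar : ℕ} {δ αbar : ℝ} (hδ : 0 ≤ δ) (hα : 0 ≤ αbar)
    {u : State → ℝ} (hu : IsArgminFeedback θ φ nbar δ αbar u) (μ : ProbabilityMeasure State)
    (k : ℕ) :
    ∫⁻ ψ, shiftedLyapunov θ φ nbar δ ψ ∂(law θ φ u hu.measurable μ k : Measure State)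
      ≤ ∫⁻ ψ, shiftedLyapunov θ φ nbar δ ψ ∂(μ : Measure State) := by
  induction k with
  | zero => exact le_rfl
  | succ k ih =>
    exact (le_self_add.trans (lintegral_law_add_decrease_le hδ hu
      (α := 0) ⟨by linarith, hα⟩ μ k)).trans ih

/-- The truncated weights are bounded and continuous, hence their means pass to the limit. -/
theorem lintegral_cutoff_le {nbar R : ℕ} (hR : nbar ≤ R) {B : ℝ≥0∞}
    {μs : ℕ → ProbabilityMeasure State} {ν : ProbabilityMeasure State}
    (h : Tendsto μs atTop (𝓝 ν)) (hB : ∀ k, ∫⁻ ψ, energy nbar ψ ∂(μs k : Measure State) ≤ B) :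
    ∫⁻ ψ, ENNReal.ofReal (cutoff nbar R ψ) ∂(ν : Measure State) ≤ B := by
  have hc : Continuous fun ψ : State => cutoff nbar R ψ :=
    (continuous_cutoff nbar R).comp continuous_subtype_val
  have hbd : ∀ ψ : State, cutoff nbar R ψ ∈ Set.Icc 0
      (∑ n ∈ Finset.range R, sigma nbar n + sigma nbar R) := fun ψ => by
    refine ⟨cutoff_nonneg _ _ _, ?_⟩
    rw [cutoff_eq]
    have h0 : 0 ≤ ∑ n ∈ Finset.range R, ‖(ψ : Fock) n‖ ^ 2 :=
      Finset.sum_nonneg fun n _ => sq_nonneg _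
    refine add_le_add (Finset.sum_le_sum fun n _ => ?_) ?_
    · have h1 : ‖(ψ : Fock) n‖ ≤ 1 := (lp.norm_apply_le_norm (by norm_num) _ _).trans ψ.norm_eq.le
      exact mul_le_of_le_one_right (sigma_nonneg _ _) (pow_le_one₀ (norm_nonneg _) h1)
    · rw [ψ.norm_eq]
      exact mul_le_of_le_one_right (sigma_nonneg _ _) (by linarith)
  refine le_of_tendsto (tendsto_lintegral_ofReal h hc hbd) (Eventually.of_forall fun k => ?_)
  exact (lintegral_mono fun ψ => ofReal_cutoff_le_energy hR _).trans (hB k)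

/-- At a Fock state where `decrease` vanishes, the displacement by `α` lowers `Q` by at most `δ`. -/
theorem neg_le_energyGain_of_mem_fockRay {θ φ : ℝ} {nbar n : ℕ} {δ α : ℝ} (hδ : 0 ≤ δ) {ψ : State}
    (hψ : ψ ∈ fockRay n) (h : decrease θ φ nbar δ α (ψ : Fock) = 0) :
    -δ ≤ energyGain nbar α (ket n) := by
  obtain ⟨z, hz, hψ⟩ := hψ
  rw [decrease, hψ, map_smul, map_smul, measG_ket, measE_ket] at h
  simp only [descent_smul, hz, Complex.norm_real, Real.norm_eq_abs, sq_abs, one_pow, one_mul] at h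
  have h1 : 0 ≤ 2 * δ * spread θ φ (z • ket n) ^ 2 := by positivity
  have h2 := Real.cos_sq_add_sin_sq (θ + n * φ)
  have h3 : descent nbar δ α (ket n) ≤ 0 := by
    calc descent nbar δ α (ket n)
        = (Real.cos (θ + n * φ) ^ 2 + Real.sin (θ + n * φ) ^ 2) * descent nbar δ α (ket n) := by
          rw [h2, one_mul]
      _ ≤ 0 := by linarith
  have h4 := (le_max_right _ _).trans h3
  rw [norm_ket] at h4
  linarith

theorem sigma_le_cutoff_of_mem_fockRay {nbar n R : ℕ} (h : R ≤ n) {ψ : State}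
    (hψ : ψ ∈ fockRay n) : sigma nbar R ≤ cutoff nbar R ψ := by
  obtain ⟨z, hz, hψ⟩ := hψ
  rw [cutoff, ψ.norm_eq, one_pow, mul_one, Finset.sum_eq_zero, sub_zero]
  intro m hm
  have : m ≠ n := by have := Finset.mem_range.mp hm; omega
  rw [hψ, lp.coeFn_smul, Pi.smul_apply, ket_apply, if_neg this]
  simp

theorem isClosed_fockRay (n : ℕ) : IsClosed (fockRay n) := by
  have e : fockRay n = {ψ : State | ‖(ψ : Fock) n‖ = 1} := by
    ext ψ
    constructor
    · rintro ⟨z, hz, hψ⟩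
      change ‖(ψ : Fock) n‖ = 1
      rw [hψ, lp.coeFn_smul, Pi.smul_apply, ket_apply, if_pos rfl, smul_eq_mul, mul_one, hz]
    · intro h
      refine ⟨(ψ : Fock) n, h, ?_⟩
      have h1 := (hasSum_norm_sq (ψ : Fock)).sub (hasSum_ite_eq n (‖(ψ : Fock) n‖ ^ 2))
      rw [ψ.norm_eq, show ‖(ψ : Fock) n‖ = 1 from h, sub_self, hasSum_zero_iff_of_nonneg] at h1
      · ext m
        have h2 := congrFun h1 m
        rw [lp.coeFn_smul, Pi.smul_apply, ket_apply, smul_eq_mul]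
        split_ifs with hm
        · rw [hm, mul_one]
        · simpa [hm] using h2
      · intro m
        dsimp only
        split_ifs with hm
        · rw [hm, show ‖(ψ : Fock) n‖ = 1 from h]; simp
        · simp
  rw [e]
  exact isClosed_eq ((continuous_coord n).comp continuous_subtype_val).norm continuous_const

/-- Finitely many Fock states off the target have a common positive lower bound of their gains. -/
theorem exists_uniform_energyGain (nbar R : ℕ) :
    ∃ δ : ℝ, 0 < δ ∧ ∀ n < R, n ≠ nbar →
      ∃ α ∈ Set.Icc (-1 : ℝ) 1, energyGain nbar α (ket n) < -δ := by
  induction R with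
  | zero => exact ⟨1, one_pos, fun n hn => absurd hn (Nat.not_lt_zero n)⟩
  | succ R ih =>
    obtain ⟨δ, hδ, h⟩ := ih
    rcases eq_or_ne R nbar with hR | hR
    · exact ⟨δ, hδ, fun n hn hne => h n (by omega) hne⟩
    · obtain ⟨α, hα, hneg⟩ := exists_energyGain_neg hR
      refine ⟨min δ (-energyGain nbar α (ket R) / 2), lt_min hδ (by linarith), fun n hn hne => ?_⟩
      rcases Nat.lt_succ_iff_lt_or_eq.mp hn with h' | rfl
      · obtain ⟨β, hβ, hlt⟩ := h n h' hne
        exact ⟨β, hβ, hlt.trans_le (neg_le_neg (min_le_left _ _))⟩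
      · refine ⟨α, hα, ?_⟩
        have := min_le_right δ (-energyGain nbar α (ket n) / 2)
        linarith

/-- A limit law charges the target and the Fock states beyond `R` only, and the latter have little
mass since the mean of the truncated weights is bounded. -/
theorem one_sub_le_measureReal_fockRay {nbar R : ℕ} {ε B : ℝ} (hε : 0 < ε)
    (hσ : 0 < sigma nbar R) (hRB : B / ε ≤ sigma nbar R)
    {ν : ProbabilityMeasure State}
    (hν : ∫⁻ ψ, ENNReal.ofReal (cutoff nbar R ψ) ∂(ν : Measure State) ≤ ENNReal.ofReal B)
    (h : ∀ᵐ ψ : State ∂(ν : Measure State), ψ ∈ fockRay nbar ∨ sigma nbar R ≤ cutoff nbar R ψ) :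
    1 - ε ≤ (ν : Measure State).real (fockRay nbar) := by
  set A : Set State := {ψ | ENNReal.ofReal (sigma nbar R) ≤ ENNReal.ofReal (cutoff nbar R ψ)}
    with hA
  have hm : Measurable fun ψ : State => ENNReal.ofReal (cutoff nbar R ψ) :=
    ((continuous_cutoff nbar R).comp continuous_subtype_val).measurable.ennreal_ofReal
  have h1 : (ν : Measure State) A ≤ ENNReal.ofReal ε := by
    refine (meas_ge_le_lintegral_div hm.aemeasurable (by simpa using hσ)
      ENNReal.ofReal_ne_top).trans ?_
    refine ENNReal.div_le_of_le_mul (hν.trans ?_)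
    rw [← ENNReal.ofReal_mul hε.le]
    refine ENNReal.ofReal_le_ofReal ?_
    rw [div_le_iff₀ hε] at hRB
    linarith
  have h2 : (ν : Measure State).real A ≤ ε := ENNReal.toReal_le_of_le_ofReal hε.le h1
  have h3 : (ν : Measure State).real (fockRay nbar ∪ A) = 1 := by
    rw [measureReal_def, (prob_compl_eq_zero_iff₀ ?_).mp ?_, ENNReal.toReal_one]
    · exact ((isClosed_fockRay nbar).measurableSet.union
        (measurableSet_le measurable_const hm)).nullMeasurableSet
    · refine measure_mono_null (fun ψ hψ => ?_) (ae_iff.mp h)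
      rintro (h | h)
      · exact hψ (Or.inl h)
      · exact hψ (Or.inr (ENNReal.ofReal_le_ofReal h))
  have h4 := measureReal_union_le (μ := (ν : Measure State)) (fockRay nbar) A
  linarith

end Cavity

theorem theorem2 (θ φ : ℝ) (nbar : ℕ)
    (hA1g : Cavity.NondegenerateEigenvalues (Cavity.measG θ φ))
    (hA1e : Cavity.NondegenerateEigenvalues (Cavity.measE θ φ))
    (ε C : ℝ) (hε : 0 < ε) (hC : 0 < C) :
    ∃ δ αbar : ℝ, 0 < δ ∧ 0 < αbar ∧
      -- `V` takes values in `[0, ∞]`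
      (∀ ψ : Cavity.State, 0 ≤ Cavity.lyapunov θ φ nbar δ ψ) ∧
      -- the argmin feedback exists
      (∃ u : Cavity.State → ℝ, Cavity.IsArgminFeedback θ φ nbar δ αbar u) ∧
      -- whichever minimizers are selected, the closed loop behaves as claimed
      ∀ (u : Cavity.State → ℝ) (hu : Cavity.IsArgminFeedback θ φ nbar δ αbar u)
        (μ : ProbabilityMeasure Cavity.State),
        ∫⁻ ψ, (Cavity.lyapunov θ φ nbar δ ψ).toENNReal ∂(μ : Measure Cavity.State)
            ≤ ENNReal.ofReal C →
        (Cavity.weakLimitPoints (Cavity.law θ φ u hu.measurable μ)).Nonempty ∧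
        Tendsto (Cavity.law θ φ u hu.measurable μ) atTop
          (𝓝ˢ (Cavity.weakLimitPoints (Cavity.law θ φ u hu.measurable μ))) ∧
        ∀ ν ∈ Cavity.weakLimitPoints (Cavity.law θ φ u hu.measurable μ),
          (ν : Measure Cavity.State).support ⊆ (⋃ n : ℕ, Cavity.fockRay n) ∧
          1 - ε ≤ (ν : Measure Cavity.State).real (Cavity.fockRay nbar) := by
  open Cavity in
  -- Limit laws will have mass at most `ε` on the levels from `R` on; `δ` is small depending on `R`.
  obtain ⟨R, hR, hRC, hσ⟩ : ∃ R, nbar ≤ R ∧ (C + 1) / ε ≤ sigma nbar R ∧ 0 < sigma nbar R :=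
    ((eventually_ge_atTop nbar).and (((tendsto_sigma nbar).eventually_ge_atTop _).and
      ((tendsto_sigma nbar).eventually_gt_atTop 0))).exists
  obtain ⟨s, hs0, hs⟩ := exists_sigma_lower_bound nbar
  obtain ⟨δ₀, hδ₀, hgain⟩ := exists_uniform_energyGain nbar R
  obtain ⟨δ, hδ, hδ1, hδs, hδδ₀⟩ : ∃ δ : ℝ, 0 < δ ∧ δ ≤ 1 ∧ 2 * δ ≤ s ∧ δ ≤ δ₀ := by
    refine ⟨min 1 (min (s / 2) δ₀), by positivity, min_le_left _ _, ?_,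
      (min_le_right _ _).trans (min_le_right _ _)⟩
    have := (min_le_right 1 (min (s / 2) δ₀)).trans (min_le_left _ _)
    linarith
  have hV := lyapunov_nonneg θ φ nbar hδ.le hδs hs
  refine ⟨δ, 1, hδ, one_pos, hV, exists_isArgminFeedback θ φ nbar δ zero_le_one,
    fun u hu μ hμ => ?_⟩
  have hW : ∫⁻ ψ, shiftedLyapunov θ φ nbar δ ψ ∂(μ : Measure State) ≤ ENNReal.ofReal (C + 1) := by
    have e : ∀ ψ : State, shiftedLyapunov θ φ nbar δ ψ
        = (lyapunov θ φ nbar δ ψ).toENNReal + ENNReal.ofReal δ :=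
      fun ψ => shiftedLyapunov_eq θ φ nbar hδ.le ψ (hV ψ)
    simp_rw [e]
    rw [lintegral_add_right _ measurable_const, lintegral_const, measure_univ, mul_one,
      ENNReal.ofReal_add hC.le zero_le_one]
    exact add_le_add hμ (ENNReal.ofReal_le_ofReal hδ1)
  have hE : ∀ k, ∫⁻ ψ, energy nbar ψ ∂(law θ φ u hu.measurable μ k : Measure State)
      ≤ ENNReal.ofReal (C + 1) := fun k =>
    (lintegral_mono fun ψ => energy_le_shiftedLyapunov θ φ nbar δ _).trans
      ((lintegral_law_le hδ.le zero_le_one hu μ k).trans hW)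
  have hcompact : IsCompact (closure (Set.range (law θ φ u hu.measurable μ))) := by
    refine isCompact_closure_of_isTightMeasureSet
      (isTightMeasureSet_of_lintegral_energy_le nbar
        (ENNReal.ofReal_ne_top (r := C + 1)) ?_)
    rintro _ ⟨_, ⟨k, rfl⟩, rfl⟩
    exact hE k
  obtain ⟨hne, hconv⟩ := tendsto_nhdsSet_limitPoints hcompact
    (Γ := law θ φ u hu.measurable μ) fun k => subset_closure (Set.mem_range_self k)
  refine ⟨hne, hconv, fun ν hν => ?_⟩
  have hdec : ∀ {α : ℝ}, α ∈ Set.Icc (-1 : ℝ) 1 →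
      ∀ᵐ ψ : State ∂(ν : Measure State), decrease θ φ nbar δ α (ψ : Fock) = 0 := fun hα =>
    ae_decrease_eq_zero hδ.le hu hα (ne_top_of_le_ne_top ENNReal.ofReal_ne_top hW) hν
  have hray : ∀ ψ : State, decrease θ φ nbar δ 0 (ψ : Fock) = 0 → ∃ n, ψ ∈ fockRay n :=
    fun ψ h => by
      refine exists_mem_fockRay_of_spread_eq_zero (cos_sq_injective hA1g hA1e) ?_
      have h1 := descent_nonneg nbar δ 0 (measG θ φ ψ)
      have h2 := descent_nonneg nbar δ 0 (measE θ φ ψ)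
      have h3 : 0 ≤ 2 * δ * spread θ φ ψ ^ 2 := by positivity
      rw [decrease] at h
      have h4 : 2 * δ * spread θ φ ψ ^ 2 = 0 := by linarith
      exact pow_eq_zero_iff two_ne_zero |>.mp
        ((mul_eq_zero.mp h4).resolve_left (by positivity))
  have h0 := hdec (α := 0) (by simp)
  constructor
  · refine (Measure.support_subset_of_isClosed (isClosed_eq
      ((continuous_decrease θ φ nbar δ 0).comp continuous_subtype_val) continuous_const)
      h0).trans ?_
    exact fun ψ hψ => Set.mem_iUnion.mpr (hray ψ hψ)
  · choose! α hα hαneg using hgain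
    have hlevels : ∀ᵐ ψ : State ∂(ν : Measure State), ∀ n, n < R → n ≠ nbar →
        decrease θ φ nbar δ (α n) (ψ : Fock) = 0 :=
      ae_all_iff.mpr fun n => by
        by_cases hn : n < R ∧ n ≠ nbar
        · filter_upwards [hdec (hα n hn.1 hn.2)] with ψ hψ _ _ using hψ
        · exact Eventually.of_forall fun ψ h h' => absurd ⟨h, h'⟩ hn
    obtain ⟨l, -, hlim⟩ := hν
    refine one_sub_le_measureReal_fockRay hε hσ hRC
      (lintegral_cutoff_le hR hlim fun k => hE (l k)) ?_
    filter_upwards [h0, hlevels] with ψ hψ hψn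
    obtain ⟨n, hn⟩ := hray ψ hψ
    rcases eq_or_ne n nbar with rfl | hne
    · exact Or.inl hn
    rcases lt_or_ge n R with hnR | hnR
    · have h1 := neg_le_energyGain_of_mem_fockRay hδ.le hn (hψn n hnR hne)
      have h2 := hαneg n hnR hne
      linarith
    · exact Or.inr (sigma_le_cutoff_of_mem_fockRay hnR hn)
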